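/- **Setting.** Let $n\ge 1$, let $X\subset\mathbb R^n$ be compact (Euclidean norm $\|\cdot\|$), let $f:X\to X$ be continuous and let $\sigma>0$ be such that $f(x)+w\in X$ for all $x\in X$, $w\in[-\sigma,\sigma]^n$. Let $\Omega=([-\sigma,\sigma]^n)^{\mathbb N}$ carry the product probability $\mathbb P=(\nu^{\otimes n})^{\otimes\mathbb N}$, where $\nu$ is the uniform distribution on $[-\sigma,\sigma]$; let $\theta$ be the shift on $\Omega$, and put $f_\omega(x)=f(x)+\omega_0$, $f^k_\omega=f_{\theta^{k-1}\omega}\circ\dots\circ f_\omega$, $\Theta(\omega,x)=(\theta\omega,f_\omega(x))$. A probability measure $\mu$ on $X$ is stationary if $\mu(A)=\int_X\mathbb P(f_\omega(x)\in A)\,d\mu(x)$ for all Borel $A$, and an ergodic stationary measure if moreover $\mathbb P\otimes\mu$ is ergodic for $\Theta$. Let $df$ be the derivative of $f$ along $X$, and let the critical set $\mathcal C\subset X$ be the set of points where the (unique) derivative does not exist or is not invertible. Write $d(x)=\mathrm{dist}(x,\mathcal C)$. Assume: * $f$ is $C^{1+\alpha}$ on $X\setminus\mathcal C$ for some $\alpha\in(0,1]$,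 i.e. $df$ is locally $\alpha$-Hölder there. * (H1) $\mathcal C$ is contained in a finite union $M\subset X$ of images of $C^1$ maps $g_i:[0,1]^{n-1}\to\mathbb R^n$, and there is a map $v$ of class $C^1$ on $\mathcal C$ with $\|v\|=1$ and $v(g_i(t))\perp \mathrm{range}\,dg_i(t)$ whenever $g_i(t)\in\mathcal C$. There are $B>1$, $\beta>0$ such that, if $\mathcal C\neq\emptyset$: for all $x\in X\setminus\mathcal C$, $u\ne0$, $$\tfrac1B\,d(x)^\beta\le\frac{\|df(x)u\|}{\|u\|}\le B\,d(x)^{-\beta},$$ and for all $x,y\in X\setminus\mathcal C$ with $\|x-y\|\le d(x)/2$, both $\big|\log\|df(x)^{-1}\|-\log\|df(y)^{-1}\|\big|$ and $\big|\log|\det df(x)|-\log|\det df(y)|\big|$ are at most $\frac{B}{d(x)^\beta}\|x-y\|$. (Where $d(x)=0$ these bounds are void.) * (H2) $Y\subset X$ is a Borel set with $\mathbb P(f_\omega(x)\in Y)=1$ for every $x\in Y$; $\mu$ is the unique ergodic stationary probability measure with $\mu(Y)=1$; and $$\lambda:=\int_Y\log\|df(x)^{-1}\|\,d\mu(x)<0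 .$$ For $\delta>0$ let $\mathrm{dist}_\delta(x,\mathcal C)=1$ if $\mathrm{dist}(x,\mathcal C)>\delta$ and $\mathrm{dist}_\delta(x,\mathcal C)=\mathrm{dist}(x,\mathcal C)$ otherwise (with $\mathrm{dist}(x,\emptyset)=\infty$). For $k\ge1$ put $$S_k(\omega,x)=\frac1k\sum_{i=0}^k\log\|df(f^i_\omega(x))^{-1}\|,\qquad Z_k(\delta,\omega,x)=\frac1k\sum_{i=0}^k-\log\mathrm{dist}_\delta(f^i_\omega(x),\mathcal C),$$ where $\log\|df(y)^{-1}\|=+\infty$ for $y\in\mathcal C$ and $-\log0=+\infty$; for $k=0$ put $S_0=Z_0=0$. Let $m$ be Lebesgue measure. **Proposition 3.1.** There is $\varepsilon_0>0$ such that for every $\varepsilon\in(0,\varepsilon_0)$ there is $\delta_0>0$ such that for every $\delta\in(0,\delta_0)$ there are $C>1$, $\gamma\in(0,1)$ and measurable sets $A_k\subset X$ $(k\ge0)$ such that, for all $k\ge0$, $m(A_k)\le C\gamma^k$ and, for every $x\in Y\setminus A_k$, $$\mathbb P\big\{\,S_k(\omega,x)>\lambda+\varepsilon\ \text{ or }\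 Z_k(\delta,\omega,x)>\varepsilon\,\big\}<C\gamma^k .$$ -/

import Mathlib

open MeasureTheory Set
open scoped ENNReal

noncomputable section

/-- `ℝⁿ` with its Euclidean norm. -/
abbrev Euc (n : ℕ) : Type := EuclideanSpace ℝ (Fin n)

/-- The closed unit cube `[0,1]ᵏ`. -/
def unitCube (k : ℕ) : Set (Euc k) := {t | ∀ j, t j ∈ Icc (0 : ℝ) 1}

/-- The data of the random maps `f_ω(x) = f(x) + ω₀`: a compact set `X ⊆ ℝⁿ`, a map `f`, continuous
on `X` (its values outside `X` are never used), and a noise amplitude `σ > 0` such that every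
`x ↦ f x + w` with `w ∈ [-σ,σ]ⁿ` maps `X` to itself. -/
structure NoisySystem (n : ℕ) where
  X : Set (Euc n)
  f : Euc n → Euc n
  σ : ℝ
  isCompact_X : IsCompact X
  continuousOn_f : ContinuousOn f X
  σ_pos : 0 < σ
  maps_to : ∀ x ∈ X, ∀ w : Fin n → Icc (-σ) σ, f x + WithLp.toLp 2 (fun j => (w j : ℝ)) ∈ X

namespace NoisySystem

variable {n : ℕ} (S : NoisySystem n)

/-! ### The noise and the random compositions -/

/-- One noise value, a point of `[-σ,σ]ⁿ`. -/
abbrev Noise : Type := Fin n → Icc (-S.σ) S.σ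

/-- `Ω = ([-σ,σ]ⁿ)^ℕ`. -/
abbrev Ω : Type := ℕ → S.Noise

/-- `ν = Leb|_[-σ,σ] / (2σ)`. -/
def ν : Measure (Icc (-S.σ) S.σ) :=
  (ENNReal.ofReal (2 * S.σ))⁻¹ • Measure.comap Subtype.val (volume : Measure ℝ)

/-- `ℙ = (ν^{⊗ n})^{⊗ ℕ}`. -/
def ℙ : Measure S.Ω := Measure.infinitePi fun _ : ℕ => Measure.pi fun _ : Fin n => S.ν

/-- The shift on `Ω`. -/
def θ (ω : S.Ω) : S.Ω := fun i => ω (i + 1)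

/-- `f_ω(x) = f(x) + ω₀`. -/
def fω (ω : S.Ω) (x : S.X) : S.X :=
  ⟨S.f x + WithLp.toLp 2 (fun j => (ω 0 j : ℝ)), S.maps_to x x.2 (ω 0)⟩

/-- The random composition `f^k_ω = f_{θ^{k-1} ω} ∘ ⋯ ∘ f_ω`. -/
def iter : ℕ → S.Ω → S.X → S.X
  | 0, _, x => x
  | k + 1, ω, x => S.fω (S.θ^[k] ω) (iter k ω x)

/-- The skew product `Θ(ω,x) = (θ ω, f_ω(x))`. -/
def Θ (p : S.Ω × S.X) : S.Ω × S.X := (S.θ p.1, S.fω p.1 p.2)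

/-- `μ` is stationary: `μ(A) = ∫ 𝒫_x(A) dμ(x)` with `𝒫_x(A) = ℙ(f_ω(x) ∈ A)`. -/
def IsStationary (μ : Measure S.X) : Prop :=
  ∀ A : Set S.X, MeasurableSet A → μ A = ∫⁻ x, S.ℙ {ω | S.fω ω x ∈ A} ∂μ

/-- `μ` is an ergodic stationary probability measure: `ℙ ⊗ μ` is ergodic for the skew product. -/
def IsErgodicStationary (μ : Measure S.X) : Prop :=
  IsProbabilityMeasure μ ∧ S.IsStationary μ ∧ Ergodic S.Θ (S.ℙ.prod μ)

/-! ### The derivative and the critical set -/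

/-- The derivative of `f : X → X`, taken along `X`. -/
def df (x : Euc n) : Euc n →L[ℝ] Euc n := fderivWithin ℝ S.f S.X x

/-- The critical set `𝒞`: the points of `X` at which there is no (unique) derivative of
`f : X → X`, or at which the derivative is not invertible. -/
def crit : Set (Euc n) :=
  {x ∈ S.X | ¬ (UniqueDiffWithinAt ℝ S.X x ∧ DifferentiableWithinAt ℝ S.f S.X x ∧
    (S.df x).IsInvertible)}

/-- `‖df(x)⁻¹‖`, for `x ∈ X \ 𝒞`. -/
def normInv (x : Euc n) : ℝ := ‖(S.df x).inverse‖

/-- `log ‖df(x)⁻¹‖`, with value `+∞` on the critical set. -/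
def logNormInv (x : Euc n) : EReal :=
  open Classical in if x ∈ S.crit then ⊤ else ((Real.log (S.normInv x) : ℝ) : EReal)

/-- The `δ`-truncated distance to the critical set. The untruncated distance is extended-valued,
so that the distance to the empty set is `∞`. -/
def distTrunc (δ : ℝ) (x : Euc n) : ℝ≥0∞ :=
  if ENNReal.ofReal δ < Metric.infEDist x S.crit then 1 else Metric.infEDist x S.crit

/-- `S_k(ω,x) = (1/k) ∑_{i=0}^k log ‖df⁻¹(f^i_ω(x))‖`. -/
def Sav (k : ℕ) (ω : S.Ω) (x : S.X) : EReal :=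
  (∑ i ∈ Finset.range (k + 1), S.logNormInv (S.iter i ω x)) / (k : EReal)

/-- `Z_k(ω,x) = (1/k) ∑_{i=0}^k -log dist_δ(f^i_ω(x), 𝒞)`; here `-log 0 = +∞`. -/
def Zav (δ : ℝ) (k : ℕ) (ω : S.Ω) (x : S.X) : EReal :=
  (∑ i ∈ Finset.range (k + 1), -ENNReal.log (S.distTrunc δ (S.iter i ω x))) / (k : EReal)

/-! ### The hypotheses -/

/-- `f` is `C^{1+α}` on `X \ 𝒞` for some `α ∈ (0,1]`: the derivative, which exists there by the
definition of `𝒞`, is locally `α`-Hölder. -/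
def IsC1Holder : Prop :=
  ∃ α : ℝ, 0 < α ∧ α ≤ 1 ∧ ∀ x ∈ S.X \ S.crit, ∃ U ∈ nhds x, ∃ K : ℝ,
    ∀ y ∈ U ∩ (S.X \ S.crit), ∀ z ∈ U ∩ (S.X \ S.crit),
      ‖S.df y - S.df z‖ ≤ K * ‖y - z‖ ^ α

/-- `𝒞` lies in a hypersurface contained in `X` with finitely many components, the `i`-th of which
is parametrized by a `C¹` map `g i` on the closed cube `[0,1]^{n-1}` (hence with bounded Jacobian),
and on `𝒞` there is a unit normal direction `v` to this hypersurface, of class `C¹`. The maps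
`g i` may degenerate, as spherical coordinates do. -/
def CritInHypersurface : Prop :=
  ∃ (N : ℕ) (g : Fin N → Euc (n - 1) → Euc n) (v : Euc n → Euc n),
    (∀ i, ContDiffOn ℝ 1 (g i) (unitCube (n - 1))) ∧
    (∀ i, ∀ t ∈ unitCube (n - 1), g i t ∈ S.X) ∧
    (S.crit ⊆ ⋃ i, g i '' unitCube (n - 1)) ∧
    ContDiffOn ℝ 1 v S.crit ∧
    (∀ y ∈ S.crit, ‖v y‖ = 1) ∧
    (∀ i, ∀ t ∈ unitCube (n - 1), g i t ∈ S.crit →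
      ∀ u, inner ℝ (v (g i t)) (fderivWithin ℝ (g i) (unitCube (n - 1)) t u) = 0)

/-- The critical set is non-degenerate: with `d = dist(x, 𝒞)`, `B⁻¹ d^β ‖u‖ ≤ ‖df(x) u‖ ≤
B d^{-β} ‖u‖` off the critical set (with the powers of `d` cleared), and `log ‖df⁻¹‖` and
`log |det df|` are Lipschitz with constant `B / d^β` at scale `d / 2`.
If `𝒞` is empty then `d` is `0` here and these conditions are void. -/
def CritNondegenerate : Prop :=
  ∃ B β : ℝ, 1 < B ∧ 0 < β ∧
    (∀ x ∈ S.X \ S.crit, ∀ u : Euc n,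
      Metric.infDist x S.crit ^ β * ‖u‖ ≤ B * ‖S.df x u‖ ∧
      Metric.infDist x S.crit ^ β * ‖S.df x u‖ ≤ B * ‖u‖) ∧
    (∀ x ∈ S.X \ S.crit, ∀ y ∈ S.X \ S.crit, ‖x - y‖ ≤ Metric.infDist x S.crit / 2 →
      |Real.log (S.normInv x) - Real.log (S.normInv y)|
          ≤ B / Metric.infDist x S.crit ^ β * ‖x - y‖ ∧
      |Real.log (abs (S.df x).det) - Real.log (abs (S.df y).det)|
          ≤ B / Metric.infDist x S.crit ^ β * ‖x - y‖)

/-- `λ = ∫_Y log ‖df(x)⁻¹‖ dμ(x)`. -/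
def lam (Y : Set S.X) (μ : Measure S.X) : ℝ := ∫ x in Y, (S.logNormInv x).toReal ∂μ

/-- `Y` is an invariant ergodic component: from each of its points the process stays in `Y` almost
surely, and `μ` is the only ergodic stationary probability measure carried by `Y`. -/
def IsErgodicComponent (Y : Set S.X) (μ : Measure S.X) : Prop :=
  MeasurableSet Y ∧ (∀ x ∈ Y, ∀ᵐ ω ∂S.ℙ, S.fω ω x ∈ Y) ∧
    S.IsErgodicStationary μ ∧ μ Yᶜ = 0 ∧
    ∀ μ' : Measure S.X, S.IsErgodicStationary μ' → μ' Yᶜ = 0 → μ' = μ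

end NoisySystem

end

/-! The noise has a density bounded by (2σ)⁻ⁿ, so from any starting point the law at each time ≥ 1,
and every stationary probability measure, is at most a fixed multiple of Lebesgue measure on X.
Everything is derived from this domination and the Markov property.

The observables, log ‖df⁻¹‖ and the truncated −log dist, are bounded by K + β · (positive part of
−log dist(x, 𝒞)). An r-tube around a Lipschitz image of a cube of dimension n − 1 has volume O(r),
so exp(s|φ|) is Lebesgue integrable for small s (`lintegral_exp_logDist`). Hence Birkhoff sums over
times 1, …, N have exponential moments bounded uniformly in the starting point.

Time averages converge in mean uniformly on Y (`exists_sum_integral_iter_le`). Otherwise averaged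
laws from bad starting points in Y, all dominated by one finite measure, have a setwise limit along
an ultrafilter. That limit is stationary and carried by Y, hence equals μ, and the domination allows
testing it against unbounded integrable φ. Identifying it with μ requires uniqueness among all
stationary measures. It follows from uniqueness among ergodic ones because each stationary
probability occupies a definite amount of volume, so repeated splitting stops at an ergodic
component.

Large deviations (`large_deviation`) follow by Chernoff's method. For a block length N with
uniformly good mean and a small t > 0, a second-order expansion bounds the exponential moment of t
times a block sum, uniformly on Y. Blocks multiply by the Markov property, and Chebyshev's
inequality gives exponential decay.

Only the term at time 0 escapes, the starting point being deterministic. It is controlled off A_k =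
{dist(x, 𝒞) ≤ exp(−ck)}, a set of volume O(exp(−ck)). -/

noncomputable section

namespace NoisySystem

variable {n : ℕ} (S : NoisySystem n)

/-! ### The one-step kernel and its density bound. -/

/-- The law of one noise value. -/
def noiseLaw : Measure S.Noise := Measure.pi fun _ : Fin n => S.ν

/-- One step of the chain with noise value `w`. -/
def step (w : S.Noise) (x : S.X) : S.X :=
  ⟨S.f x + WithLp.toLp 2 (fun j => (w j : ℝ)), S.maps_to x x.2 w⟩

/-- The bound `(2σ)⁻ⁿ` on the transition densities. -/
def densBound : ℝ≥0∞ := (ENNReal.ofReal (2 * S.σ))⁻¹ ^ n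

/-- Lebesgue measure on `X`. -/
def vol : Measure S.X := Measure.comap Subtype.val (volume : Measure (Euc n))

/-- Prepend a noise value to a noise sequence. -/
def cons (w : S.Noise) (ω : S.Ω) : S.Ω
  | 0 => w
  | i + 1 => ω i

lemma map_val_ν : S.ν.map Subtype.val =
    (ENNReal.ofReal (2 * S.σ))⁻¹ • (volume : Measure ℝ).restrict (Icc (-S.σ) S.σ) := by
  rw [ν, Measure.map_smul, map_comap_subtype_coe measurableSet_Icc]

instance : IsProbabilityMeasure S.ν := by
  constructor
  have h := congrArg (fun m => m univ) S.map_val_ν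
  have hσ := S.σ_pos
  simp only [Measure.map_apply measurable_subtype_coe MeasurableSet.univ, preimage_univ] at h
  rw [h]
  simp only [Measure.smul_apply, MeasurableSet.univ, Measure.restrict_apply, univ_inter,
    Real.volume_Icc, smul_eq_mul]
  rw [show S.σ - -S.σ = 2 * S.σ by ring]
  exact ENNReal.inv_mul_cancel (by simpa using hσ) ENNReal.ofReal_ne_top

instance : IsProbabilityMeasure S.noiseLaw := by unfold noiseLaw; infer_instance

instance : IsProbabilityMeasure S.ℙ := by unfold ℙ; infer_instance

lemma densBound_ne_top : S.densBound ≠ ∞ := by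
  have hσ := S.σ_pos
  exact ENNReal.pow_ne_top (ENNReal.inv_ne_top.2 (by simpa using hσ))

lemma map_coe_noiseLaw_le :
    S.noiseLaw.map (fun w j => (w j : ℝ)) ≤ S.densBound • (volume : Measure (Fin n → ℝ)) := by
  have h1 : S.noiseLaw.map (fun w j => (w j : ℝ)) =
      Measure.pi (fun _ : Fin n => S.ν.map Subtype.val) := by
    have : IsProbabilityMeasure (S.ν.map Subtype.val) :=
      Measure.isProbabilityMeasure_map measurable_subtype_coe.aemeasurable
    exact Measure.pi_map_pi (fun _ => measurable_subtype_coe.aemeasurable)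
  have h2 : Measure.pi (fun _ : Fin n => S.ν.map Subtype.val) =
      S.densBound • (volume : Measure (Fin n → ℝ)).restrict (pi univ fun _ => Icc (-S.σ) S.σ) := by
    have : IsProbabilityMeasure (S.ν.map Subtype.val) :=
      Measure.isProbabilityMeasure_map measurable_subtype_coe.aemeasurable
    refine Measure.pi_eq fun s hs => ?_
    rw [Measure.smul_apply, Measure.restrict_apply (MeasurableSet.univ_pi hs), ← pi_inter_distrib,
      volume_pi_pi, S.map_val_ν]
    simp only [Measure.smul_apply, smul_eq_mul, Finset.prod_mul_distrib, Finset.prod_const,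
      Finset.card_univ, Fintype.card_fin, densBound]
    congr 1
    exact Finset.prod_congr rfl fun i _ => (Measure.restrict_apply (hs i)).symm
  rw [h1, h2]
  gcongr
  exact Measure.restrict_le_self

lemma measurable_step : Measurable fun p : S.Noise × S.X => S.step p.1 p.2 := by
  refine Measurable.subtype_mk ?_
  have hf : Measurable fun x : S.X => S.f x :=
    (continuousOn_iff_continuous_domRestrict.1 S.continuousOn_f).measurable
  refine (hf.comp measurable_snd).add ?_
  refine (PiLp.continuous_toLp 2 _).measurable.comp ?_
  exact measurable_pi_lambda _ fun j =>
    measurable_subtype_coe.comp ((measurable_pi_apply j).comp measurable_fst)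

lemma measurable_step_left (x : S.X) : Measurable fun w => S.step w x :=
  S.measurable_step.comp (measurable_id.prodMk measurable_const)

lemma measurableSet_X : MeasurableSet S.X := S.isCompact_X.measurableSet

lemma vol_apply (A : Set S.X) : S.vol A = volume (Subtype.val '' A : Set (Euc n)) :=
  comap_subtype_coe_apply S.measurableSet_X _ _

instance : IsFiniteMeasure S.vol := by
  constructor
  rw [S.vol_apply, image_univ, Subtype.range_coe]
  exact S.isCompact_X.measure_lt_top

instance : CompactSpace S.X := isCompact_iff_compactSpace.1 S.isCompact_X

/-- For fixed `x` the new position is a translate of the noise, and translations preserve volume; no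
regularity of `f` enters. -/
lemma map_step_le (x : S.X) :
    S.noiseLaw.map (fun w => S.step w x) ≤ S.densBound • S.vol := by
  refine Measure.le_iff.2 fun A hA => ?_
  have hA' : MeasurableSet (Subtype.val '' A : Set (Euc n)) := S.measurableSet_X.subtype_image hA
  rw [Measure.map_apply (S.measurable_step_left x) hA]
  set B : Set (Fin n → ℝ) := (fun u => S.f x + WithLp.toLp 2 u) ⁻¹' (Subtype.val '' A) with hB
  have hmp : MeasurePreserving (fun u : Fin n → ℝ => S.f x + WithLp.toLp 2 u) :=
    (measurePreserving_add_left volume (S.f x)).comp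
      (PiLp.volume_preserving_toLp (Fin n))
  have hsub : (fun w => S.step w x) ⁻¹' A = (fun (w : S.Noise) j => (w j : ℝ)) ⁻¹' B := by
    ext w
    simp only [mem_preimage, hB, mem_image]
    constructor
    · exact fun h => ⟨_, h, rfl⟩
    · rintro ⟨y, hy, hyw⟩
      have : y = S.step w x := Subtype.ext hyw
      exact this ▸ hy
  have hBm : MeasurableSet B := hmp.measurable hA'
  have hcoe : Measurable (fun (w : S.Noise) j => (w j : ℝ)) :=
    measurable_pi_lambda _ fun j => measurable_subtype_coe.comp (measurable_pi_apply j)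
  rw [hsub, ← Measure.map_apply hcoe hBm]
  refine (S.map_coe_noiseLaw_le B).trans_eq ?_
  rw [Measure.smul_apply, Measure.smul_apply, hB, hmp.measure_preimage hA'.nullMeasurableSet,
    S.vol_apply]

lemma lintegral_step_le (x : S.X) (g : S.X → ℝ≥0∞) (hg : Measurable g) :
    ∫⁻ w, g (S.step w x) ∂S.noiseLaw ≤ S.densBound * ∫⁻ y, g y ∂S.vol := by
  rw [← lintegral_map hg (S.measurable_step_left x)]
  exact (lintegral_mono' (S.map_step_le x) le_rfl).trans_eq (lintegral_smul_measure _ _)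

/-! ### The first noise value and the rest -/

lemma measurable_θ : Measurable S.θ :=
  measurable_pi_lambda _ fun i => measurable_pi_apply (i + 1)

lemma measurable_cons : Measurable fun p : S.Noise × S.Ω => S.cons p.1 p.2 := by
  refine measurable_pi_lambda _ fun i => ?_
  cases i with
  | zero => exact measurable_fst
  | succ i => exact (measurable_pi_apply i).comp measurable_snd

lemma map_cons : (S.noiseLaw.prod S.ℙ).map (fun p => S.cons p.1 p.2) = S.ℙ := by
  refine Measure.eq_infinitePi (μ := fun _ : ℕ => S.noiseLaw) fun s t ht => ?_
  -- The index set is enlarged to an initial segment, with trivial constraints on the added indices,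
  -- so that coordinate 0 splits off cleanly.
  obtain ⟨N, hN⟩ := s.exists_nat_subset_range
  set t' : ℕ → Set S.Noise := fun i => if i ∈ s then t i else univ with ht'
  have ht'm : ∀ i, MeasurableSet (t' i) := fun i => by
    simp only [ht']; split_ifs; exacts [ht i, MeasurableSet.univ]
  have e1 : (s : Set ℕ).pi t = (Finset.range (N + 1) : Set ℕ).pi t' := by
    ext ω
    simp only [Set.mem_pi, Finset.mem_coe, ht']
    constructor
    · intro h i _
      split_ifs with hi
      exacts [h i hi, mem_univ _]
    · intro h i hi
      have := h i (Finset.mem_range.2 (Nat.lt_succ_of_lt (Finset.mem_range.1 (hN hi))))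
      rwa [if_pos hi] at this
  have e2 : ∏ i ∈ s, S.noiseLaw (t i) = ∏ i ∈ Finset.range (N + 1), S.noiseLaw (t' i) := by
    rw [← Finset.prod_subset (hN.trans (Finset.range_mono (Nat.le_succ N)))]
    · exact Finset.prod_congr rfl fun i hi => by simp [ht', hi]
    · intro i _ hi
      simp [ht', hi]
  have e3 : (fun p : S.Noise × S.Ω => S.cons p.1 p.2) ⁻¹' (Finset.range (N + 1) : Set ℕ).pi t' =
      t' 0 ×ˢ (Finset.range N : Set ℕ).pi fun i => t' (i + 1) := by
    ext ⟨w, ω⟩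
    simp only [mem_preimage, Set.mem_pi, Finset.mem_coe, Finset.mem_range, mem_prod]
    constructor
    · exact fun h => ⟨h 0 (Nat.succ_pos N), fun i hi => h (i + 1) (Nat.succ_lt_succ hi)⟩
    · rintro ⟨h0, h⟩ i hi
      cases i with
      | zero => exact h0
      | succ i => exact h i (Nat.lt_of_succ_lt_succ hi)
  rw [e1, e2, Measure.map_apply S.measurable_cons
    (MeasurableSet.pi (Finset.countable_toSet _) fun i _ => ht'm i), e3, Measure.prod_prod,
    Finset.prod_range_succ', mul_comm]
  congr 1
  exact Measure.infinitePi_pi (μ := fun _ : ℕ => S.noiseLaw) fun i _ => ht'm (i + 1)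

lemma lintegral_cons (F : S.Ω → ℝ≥0∞) (hF : Measurable F) :
    ∫⁻ ω, F ω ∂S.ℙ = ∫⁻ w, ∫⁻ ω, F (S.cons w ω) ∂S.ℙ ∂S.noiseLaw := by
  conv_lhs => rw [← S.map_cons]
  rw [lintegral_map hF S.measurable_cons]
  exact lintegral_prod _ (hF.comp S.measurable_cons).aemeasurable

lemma measure_eq_lintegral_cons {E : Set S.Ω} (hE : MeasurableSet E) :
    S.ℙ E = ∫⁻ w, S.ℙ {ω | S.cons w ω ∈ E} ∂S.noiseLaw := by
  conv_lhs => rw [← S.map_cons]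
  rw [Measure.map_apply S.measurable_cons hE, Measure.prod_apply (S.measurable_cons hE)]
  rfl

lemma measurableSet_forall_lt (N : ℕ) {U : ℕ → Set S.Noise} (hU : ∀ i, MeasurableSet (U i)) :
    MeasurableSet {ω : S.Ω | ∀ i < N, ω i ∈ U i} := by
  have : {ω : S.Ω | ∀ i < N, ω i ∈ U i} = ⋂ i, ⋂ (_ : i < N), (fun ω : S.Ω => ω i) ⁻¹' U i := by
    ext; simp
  rw [this]
  exact MeasurableSet.iInter fun i => MeasurableSet.iInter fun _ => measurable_pi_apply i (hU i)

@[simp] lemma θ_cons (w : S.Noise) (ω : S.Ω) : S.θ (S.cons w ω) = ω := rfl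

@[simp] lemma fω_cons (w : S.Noise) (ω : S.Ω) (x : S.X) : S.fω (S.cons w ω) x = S.step w x := rfl

/-- `iter` peels off the last map; peeling off the first one is what conditioning on the first noise
value needs. -/
lemma iter_succ' (k : ℕ) (ω : S.Ω) (x : S.X) :
    S.iter (k + 1) ω x = S.iter k (S.θ ω) (S.fω ω x) := by
  induction k with
  | zero => rfl
  | succ k ih =>
    rw [iter, ih, iter]
    rw [← Function.iterate_succ_apply]

@[simp] lemma iter_cons (k : ℕ) (w : S.Noise) (ω : S.Ω) (x : S.X) :
    S.iter (k + 1) (S.cons w ω) x = S.iter k ω (S.step w x) := by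
  rw [iter_succ', θ_cons, fω_cons]

lemma measurable_fω : Measurable fun p : S.Ω × S.X => S.fω p.1 p.2 :=
  S.measurable_step.comp (g := fun p : S.Noise × S.X => S.step p.1 p.2)
    (f := fun p : S.Ω × S.X => (p.1 0, p.2)) (((measurable_pi_apply 0).comp measurable_fst).prodMk measurable_snd)

lemma measurable_Θ : Measurable S.Θ :=
  (S.measurable_θ.comp measurable_fst).prodMk S.measurable_fω

lemma measurable_iter (k : ℕ) : Measurable fun p : S.Ω × S.X => S.iter k p.1 p.2 := by
  induction k with
  | zero => exact measurable_snd
  | succ k ih =>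
    exact S.measurable_fω.comp (((S.measurable_θ.iterate k).comp measurable_fst).prodMk ih)

lemma measurable_iter_left (k : ℕ) (x : S.X) : Measurable fun ω => S.iter k ω x :=
  (S.measurable_iter k).comp (measurable_id.prodMk measurable_const)

lemma measurable_lintegral_step (g : S.X → ℝ≥0∞) (hg : Measurable g) :
    Measurable fun x => ∫⁻ w, g (S.step w x) ∂S.noiseLaw :=
  Measurable.lintegral_prod_left' (f := fun p : S.Noise × S.X => g (S.step p.1 p.2))
    (hg.comp S.measurable_step)

/-- The Markov property at the last step. -/
lemma lintegral_iter_succ (k : ℕ) (x : S.X) (g : S.X → ℝ≥0∞) (hg : Measurable g) :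
    ∫⁻ ω, g (S.iter (k + 1) ω x) ∂S.ℙ =
      ∫⁻ ω, ∫⁻ w, g (S.step w (S.iter k ω x)) ∂S.noiseLaw ∂S.ℙ := by
  induction k generalizing x with
  | zero =>
    rw [S.lintegral_cons (fun ω => g (S.iter 1 ω x)) (hg.comp (S.measurable_iter_left 1 x))]
    simp [iter]
  | succ k ih =>
    rw [S.lintegral_cons (fun ω => g (S.iter (k + 2) ω x))
        (hg.comp (S.measurable_iter_left (k + 2) x)),
      S.lintegral_cons (fun ω => ∫⁻ w, g (S.step w (S.iter (k + 1) ω x)) ∂S.noiseLaw)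
        ((S.measurable_lintegral_step g hg).comp
        (S.measurable_iter_left (k + 1) x))]
    simp only [iter_cons]
    exact lintegral_congr fun w => ih _

/-- Given the position at time `k`, one more step smooths the law. At time 0 the law is a point
mass, which is why sums and averages below start at time 1. -/
lemma map_iter_succ_le (k : ℕ) (x : S.X) :
    S.ℙ.map (fun ω => S.iter (k + 1) ω x) ≤ S.densBound • S.vol := by
  refine Measure.le_iff.2 fun A hA => ?_
  rw [← lintegral_indicator_one hA, lintegral_map (measurable_one.indicator hA)
    (S.measurable_iter_left _ x), S.lintegral_iter_succ k x _ (measurable_one.indicator hA)]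
  calc _ ≤ ∫⁻ _, S.densBound * ∫⁻ y : S.X, A.indicator 1 y ∂S.vol ∂S.ℙ :=
        lintegral_mono fun ω => S.lintegral_step_le _ _ (measurable_one.indicator hA)
    _ = _ := by simp [lintegral_indicator_one hA]

end NoisySystem

end

noncomputable section

namespace NoisySystem

variable {n : ℕ} (S : NoisySystem n)

/-! ### Stationary measures -/

variable {S} {m : Measure S.X}

lemma isStationary_iff_map [SFinite m] :
    S.IsStationary m ↔ (S.noiseLaw.prod m).map (fun p => S.step p.1 p.2) = m := by
  have key : ∀ A : Set S.X, MeasurableSet A →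
      (S.noiseLaw.prod m).map (fun p => S.step p.1 p.2) A =
        ∫⁻ x, S.ℙ {ω | S.fω ω x ∈ A} ∂m := by
    intro A hA
    rw [Measure.map_apply S.measurable_step hA,
      Measure.prod_apply_symm (S.measurable_step hA)]
    refine lintegral_congr fun x => ?_
    have hA' : MeasurableSet {w | S.step w x ∈ A} := S.measurable_step_left x hA
    change S.noiseLaw {w | S.step w x ∈ A} = _
    rw [S.measure_eq_lintegral_cons (E := {ω | S.fω ω x ∈ A}) (S.measurable_iter_left 1 x hA),
      ← lintegral_indicator_one hA']
    refine lintegral_congr fun w => ?_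
    by_cases hw : S.step w x ∈ A <;> simp [indicator, hw]
  constructor
  · exact fun h => Measure.ext fun A hA => (key A hA).trans (h A hA).symm
  · exact fun h A hA => by rw [← key A hA, h]

lemma IsStationary.lintegral_step [SFinite m] (hm : S.IsStationary m) {g : S.X → ℝ≥0∞}
    (hg : Measurable g) :
    ∫⁻ x, ∫⁻ w, g (S.step w x) ∂S.noiseLaw ∂m = ∫⁻ x, g x ∂m := by
  conv_rhs => rw [← isStationary_iff_map.1 hm, lintegral_map hg S.measurable_step]
  exact (lintegral_prod_symm' _ (hg.comp S.measurable_step)).symm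

lemma isStationary_of_measure_step [SFinite m]
    (h : ∀ A, MeasurableSet A → ∫⁻ x, S.noiseLaw {w | S.step w x ∈ A} ∂m = m A) :
    S.IsStationary m := by
  refine isStationary_iff_map.2 (Measure.ext fun A hA => ?_)
  rw [Measure.map_apply S.measurable_step hA, Measure.prod_apply_symm (S.measurable_step hA)]
  exact h A hA

lemma IsStationary.measure_step [SFinite m] (hm : S.IsStationary m) {A : Set S.X}
    (hA : MeasurableSet A) : ∫⁻ x, S.noiseLaw {w | S.step w x ∈ A} ∂m = m A := by
  conv_rhs => rw [← isStationary_iff_map.1 hm]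
  rw [Measure.map_apply S.measurable_step hA, Measure.prod_apply_symm (S.measurable_step hA)]
  rfl

lemma IsStationary.smul (hm : S.IsStationary m) (a : ℝ≥0∞) : S.IsStationary (a • m) := by
  intro A hA
  rw [Measure.smul_apply, lintegral_smul_measure, ← hm A hA]

lemma IsStationary.ae_step [SFinite m] (hm : S.IsStationary m) {p : S.X → Prop}
    (hp : ∀ᵐ x ∂m, p x) : ∀ᵐ x ∂m, ∀ᵐ w ∂S.noiseLaw, p (S.step w x) := by
  have h : ∀ᵐ q ∂(S.noiseLaw.prod m), p (S.step q.1 q.2) := by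
    rw [← isStationary_iff_map.1 hm] at hp
    exact ae_of_ae_map S.measurable_step.aemeasurable hp
  rw [← Measure.prod_swap] at h
  exact Measure.ae_ae_of_ae_prod (ae_of_ae_map measurable_swap.aemeasurable h)

lemma IsStationary.le_vol [IsProbabilityMeasure m] (hm : S.IsStationary m) :
    m ≤ S.densBound • S.vol := by
  refine Measure.le_iff.2 fun A hA => ?_
  rw [← lintegral_indicator_one hA, ← hm.lintegral_step (measurable_one.indicator hA)]
  calc _ ≤ ∫⁻ _, S.densBound * ∫⁻ y : S.X, A.indicator 1 y ∂S.vol ∂m :=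
        lintegral_mono fun x => S.lintegral_step_le _ _ (measurable_one.indicator hA)
    _ = _ := by simp [lintegral_indicator_one hA]

/-- On rectangles: the new point depends only on `ω 0` and `x`, hence is independent of the shifted
noise, and it again has law `m`. -/
lemma IsStationary.measurePreserving_Θ [IsProbabilityMeasure m] (hm : S.IsStationary m) :
    MeasurePreserving S.Θ (S.ℙ.prod m) (S.ℙ.prod m) := by
  refine ⟨S.measurable_Θ, Measure.ext_prod fun {s t} hs ht => ?_⟩
  rw [Measure.map_apply S.measurable_Θ (hs.prod ht),
    Measure.prod_apply_symm (S.measurable_Θ (hs.prod ht)), Measure.prod_prod,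
    ← hm.measure_step ht, ← lintegral_const_mul' _ _ (measure_ne_top _ _)]
  refine lintegral_congr fun x => ?_
  have hst : MeasurableSet ((fun ω => (ω, x)) ⁻¹' (S.Θ ⁻¹' s ×ˢ t)) :=
    (measurable_id.prodMk measurable_const) (S.measurable_Θ (hs.prod ht))
  change S.ℙ ((fun ω => (ω, x)) ⁻¹' (S.Θ ⁻¹' s ×ˢ t)) = _
  have ht' : MeasurableSet {w | S.step w x ∈ t} := S.measurable_step_left x ht
  rw [S.measure_eq_lintegral_cons hst, 
    ← lintegral_indicator_const ht']
  refine lintegral_congr fun w => ?_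
  have : {ω | S.cons w ω ∈ (fun ω => (ω, x)) ⁻¹' (S.Θ ⁻¹' s ×ˢ t)} =
      {ω | ω ∈ s ∧ S.step w x ∈ t} := rfl
  rw [this]
  by_cases hw : S.step w x ∈ t <;> simp [indicator, hw]

/-! ### A stationary measure that cannot be split is ergodic -/

/-- `B` is invariant for the chain started from `m`. -/
def IsInvariantSet (m : Measure S.X) (B : Set S.X) : Prop :=
  ∀ᵐ x ∂m, ∀ᵐ w ∂S.noiseLaw, (S.step w x ∈ B ↔ x ∈ B)

lemma IsInvariantSet.compl {B : Set S.X} (hB : IsInvariantSet m B) : IsInvariantSet m Bᶜ := by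
  filter_upwards [hB] with x hx
  filter_upwards [hx] with w hw
  simp [hw]

/-- Mass that arrives in `A ∩ B` can only have started in `B`, and mass starting in `B` stays there.
-/
lemma IsStationary.restrict [IsFiniteMeasure m] (hm : S.IsStationary m) {B : Set S.X}
    (hBm : MeasurableSet B) (hB : IsInvariantSet m B) : S.IsStationary (m.restrict B) := by
  refine isStationary_of_measure_step fun A hA => ?_
  rw [Measure.restrict_apply hA, ← hm.measure_step (hA.inter hBm), ← lintegral_indicator hBm]
  refine lintegral_congr_ae ?_
  filter_upwards [hB] with x hx
  by_cases hxB : x ∈ B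
  · rw [indicator_of_mem hxB]
    refine measure_congr ?_
    filter_upwards [hx] with w hw
    have : S.step w x ∈ B := hw.2 hxB
    exact propext ⟨fun h => ⟨h, this⟩, fun h => h.1⟩
  · rw [indicator_of_notMem hxB]
    symm
    rw [measure_eq_zero_iff_ae_notMem]
    filter_upwards [hx] with w hw h
    exact hxB (hw.1 h.2)

/-- A bounded harmonic function is constant along the chain started from a stationary measure. -/
lemma IsStationary.harmonic_step_eq [IsProbabilityMeasure m] (hm : S.IsStationary m)
    {h : S.X → ℝ} (hh : Measurable h) (h0 : ∀ x, ‖h x‖ ≤ 1)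
    (harm : ∀ x, ∫ w, h (S.step w x) ∂S.noiseLaw = h x) :
    ∀ᵐ x ∂m, ∀ᵐ w ∂S.noiseLaw, h (S.step w x) = h x := by
  have hv : Measurable fun p : S.Noise × S.X => h (S.step p.1 p.2) := hh.comp S.measurable_step
  have hu : Measurable fun p : S.Noise × S.X => h p.2 := hh.comp measurable_snd
  have bd : ∀ {f g : S.Noise × S.X → ℝ}, Measurable f → Measurable g → (∀ p, ‖f p‖ ≤ 1) →
      (∀ p, ‖g p‖ ≤ 1) → Integrable (fun p => f p * g p) (S.noiseLaw.prod m) := by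
    intro f g hf hg hf1 hg1
    refine Integrable.of_bound (hf.mul hg).aestronglyMeasurable 1 (Filter.Eventually.of_forall ?_)
    intro p
    rw [norm_mul]
    exact mul_le_one₀ (hf1 p) (norm_nonneg _) (hg1 p)
  have i1 := bd hv hv (fun p => h0 _) (fun p => h0 _)
  have i2 := bd hu hv (fun p => h0 _) (fun p => h0 _)
  have i3 := bd hu hu (fun p => h0 _) (fun p => h0 _)
  have e1 : ∫ p, h (S.step p.1 p.2) * h (S.step p.1 p.2) ∂(S.noiseLaw.prod m) =
      ∫ x, h x * h x ∂m := by
    conv_rhs => rw [← isStationary_iff_map.1 hm]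
    exact (integral_map (f := fun y => h y * h y) S.measurable_step.aemeasurable
      (hh.mul hh).aestronglyMeasurable).symm
  have e2 : ∫ p, h p.2 * h (S.step p.1 p.2) ∂(S.noiseLaw.prod m) = ∫ x, h x * h x ∂m := by
    rw [integral_prod_symm _ i2]
    refine integral_congr_ae (Filter.Eventually.of_forall fun x => ?_)
    simp only
    rw [integral_const_mul, harm]
  have e3 : ∫ p, h p.2 * h p.2 ∂(S.noiseLaw.prod m) = ∫ x, h x * h x ∂m := by
    rw [integral_prod_symm _ i3]
    simp
  -- Both squares integrate to ∫ h² by stationarity, and the cross term does by harmonicity, so the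
  -- expanded square cancels.
  have e : ∫ p, (h (S.step p.1 p.2) - h p.2) ^ 2 ∂(S.noiseLaw.prod m) = 0 := by
    have : ∀ p : S.Noise × S.X, (h (S.step p.1 p.2) - h p.2) ^ 2 =
        h (S.step p.1 p.2) * h (S.step p.1 p.2) - 2 * (h p.2 * h (S.step p.1 p.2)) +
          h p.2 * h p.2 := fun p => by ring
    simp only [this]
    have i12 : Integrable (fun p : S.Noise × S.X => h (S.step p.1 p.2) * h (S.step p.1 p.2) -
        2 * (h p.2 * h (S.step p.1 p.2))) (S.noiseLaw.prod m) := i1.sub (i2.const_mul 2)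
    rw [integral_add i12 i3, integral_sub i1 (i2.const_mul 2),
      integral_const_mul, e1, e2, e3]
    ring
  have hint : Integrable (fun p : S.Noise × S.X => (h (S.step p.1 p.2) - h p.2) ^ 2)
      (S.noiseLaw.prod m) := by
    refine ((i1.sub (i2.const_mul 2)).add i3).congr (Filter.Eventually.of_forall fun p => ?_)
    simp only [Pi.add_apply, Pi.sub_apply]
    ring
  have hae := (integral_eq_zero_iff_of_nonneg (fun p => sq_nonneg _) hint).1 e
  have hae' : ∀ᵐ p ∂(S.noiseLaw.prod m), h (S.step p.1 p.2) = h p.2 := by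
    filter_upwards [hae] with p hp
    exact sub_eq_zero.1 (pow_eq_zero_iff two_ne_zero |>.1 hp)
  rw [← Measure.prod_swap] at hae'
  exact Measure.ae_ae_of_ae_prod (ae_of_ae_map measurable_swap.aemeasurable hae')

/-- An invariant set of the skew product whose sections have constant measure is independent of
every square cylinder. -/
lemma IsStationary.measure_cylinder_inter_section [IsProbabilityMeasure m]
    (hm : S.IsStationary m) {D : Set (S.Ω × S.X)} (hD : MeasurableSet D) (hinv : S.Θ ⁻¹' D = D)
    {p : ℝ≥0∞} (hp : ∀ᵐ x ∂m, S.ℙ {ω | (ω, x) ∈ D} = p) (N : ℕ) :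
    ∀ U : ℕ → Set S.Noise, (∀ i, MeasurableSet (U i)) →
      ∀ᵐ x ∂m, S.ℙ ({ω | ∀ i < N, ω i ∈ U i} ∩ {ω | (ω, x) ∈ D}) =
        p * S.ℙ {ω | ∀ i < N, ω i ∈ U i} := by
  have hsec : ∀ x, MeasurableSet {ω | (ω, x) ∈ D} := fun x =>
    (measurable_id.prodMk measurable_const) hD
  have hdec : ∀ (U : ℕ → Set S.Noise) (N : ℕ) (w : S.Noise) (ω : S.Ω),
      (∀ i < N + 1, S.cons w ω i ∈ U i) ↔ w ∈ U 0 ∧ ∀ i < N, ω i ∈ U (i + 1) := by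
    intro U N w ω
    constructor
    · exact fun h => ⟨h 0 (Nat.succ_pos N), fun i hi => h (i + 1) (Nat.succ_lt_succ hi)⟩
    · rintro ⟨h0, h⟩ i hi
      cases i with
      | zero => exact h0
      | succ i => exact h i (Nat.lt_of_succ_lt_succ hi)
  induction N with
  | zero =>
    intro U _
    filter_upwards [hp] with x hx
    simpa using hx
  | succ N ih =>
    intro U hU
    have hE := S.measurableSet_forall_lt (N + 1) hU
    have a1 : S.ℙ {ω | ∀ i < N + 1, ω i ∈ U i} =
        S.ℙ {ω | ∀ i < N, ω i ∈ U (i + 1)} * S.noiseLaw (U 0) := by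
      rw [S.measure_eq_lintegral_cons hE, ← lintegral_indicator_const (hU 0)]
      refine lintegral_congr fun w => ?_
      have : {ω | S.cons w ω ∈ {ω : S.Ω | ∀ i < N + 1, ω i ∈ U i}} =
          {ω | w ∈ U 0 ∧ ∀ i < N, ω i ∈ U (i + 1)} := ext fun ω => hdec U N w ω
      rw [this]
      by_cases hw : w ∈ U 0 <;> simp [indicator, hw]
    -- The induction hypothesis is needed at the random next point; stationarity transports the
    -- almost-everywhere statement there. Invariance of `D` then trades `(cons w ω, x)` for `(ω,
    -- step w x)`.
    filter_upwards [hm.ae_step (ih (fun i => U (i + 1)) fun i => hU _)] with x hx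
    rw [S.measure_eq_lintegral_cons (hE.inter (hsec x)), a1, ← mul_assoc,
      ← lintegral_indicator_const (hU 0)]
    refine lintegral_congr_ae ?_
    filter_upwards [hx] with w hxw
    have : {ω | S.cons w ω ∈ {ω : S.Ω | ∀ i < N + 1, ω i ∈ U i} ∩ {ω | (ω, x) ∈ D}} =
        {ω | (w ∈ U 0 ∧ ∀ i < N, ω i ∈ U (i + 1)) ∧ (ω, S.step w x) ∈ D} := by
      refine ext fun ω => and_congr (hdec U N w ω) ?_
      change (S.cons w ω, x) ∈ D ↔ _
      conv_lhs => rw [← hinv]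
      rfl
    rw [this]
    by_cases hw : w ∈ U 0
    · rw [indicator_of_mem hw, ← hxw]
      simp only [hw, true_and]
      rfl
    · simp [indicator, hw]

/-- A zero-one law: `D` is independent of every cylinder times a set of positions, hence of every
event, including itself, so p = p². -/
lemma IsStationary.measure_eq_zero_or_one_of_const [IsProbabilityMeasure m]
    (hm : S.IsStationary m) {D : Set (S.Ω × S.X)} (hD : MeasurableSet D) (hinv : S.Θ ⁻¹' D = D)
    {p : ℝ≥0∞} (hp : ∀ᵐ x ∂m, S.ℙ {ω | (ω, x) ∈ D} = p) :
    S.ℙ.prod m D = 0 ∨ S.ℙ.prod m D = 1 := by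
  have hsec : ∀ x, MeasurableSet {ω | (ω, x) ∈ D} := fun x =>
    (measurable_id.prodMk measurable_const) hD
  have hDp : S.ℙ.prod m D = p := by
    rw [Measure.prod_apply_symm hD]
    exact (lintegral_congr_ae hp).trans (by simp)
  have hptop : p ≠ ∞ := hDp ▸ measure_ne_top _ _
  have key : (S.ℙ.prod m).restrict D = p • (S.ℙ.prod m) := by
    refine Measure.ext_prod fun {s t} hs ht => ?_
    have hrect : ∀ s, MeasurableSet s → (S.ℙ.prod m).restrict D (s ×ˢ t) =
        ∫⁻ x in t, S.ℙ (s ∩ {ω | (ω, x) ∈ D}) ∂m := by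
      intro s hs
      rw [Measure.restrict_apply (hs.prod ht),
        Measure.prod_apply_symm ((hs.prod ht).inter hD), ← lintegral_indicator ht]
      refine lintegral_congr fun x => ?_
      by_cases hx : x ∈ t
      · rw [indicator_of_mem hx]
        congr 1
        ext ω
        simp [hx]
      · rw [indicator_of_notMem hx]
        convert measure_empty (μ := S.ℙ)
        ext ω
        simp [hx]
    -- With `t` fixed both sides are finite measures in `s`, so agreement on the generating π-system
    -- of cylinders suffices.
    set ρ₁ : Measure S.Ω := (((S.ℙ.prod m).restrict D).restrict (univ ×ˢ t)).map Prod.fst with hρ₁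
    set ρ₂ : Measure S.Ω := ((p • (S.ℙ.prod m)).restrict (univ ×ˢ t)).map Prod.fst with hρ₂
    have hfin : IsFiniteMeasure (p • (S.ℙ.prod m)) := Measure.smul_finite _ hptop
    have hpre : ∀ s : Set S.Ω, Prod.fst ⁻¹' s ∩ univ ×ˢ t = s ×ˢ t := by
      intro s
      ext ⟨a, b⟩
      simp
    have r1 : ∀ s, MeasurableSet s → ρ₁ s = ∫⁻ x in t, S.ℙ (s ∩ {ω | (ω, x) ∈ D}) ∂m := by
      intro s hs
      rw [hρ₁, Measure.map_apply measurable_fst hs, Measure.restrict_apply (measurable_fst hs),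
        hpre, hrect s hs]
    have r2 : ∀ s, MeasurableSet s → ρ₂ s = p * (S.ℙ s * m t) := by
      intro s hs
      rw [hρ₂, Measure.map_apply measurable_fst hs, Measure.restrict_apply (measurable_fst hs),
        hpre, Measure.smul_apply, Measure.prod_prod, smul_eq_mul]
    have hcyl : ∀ (N : ℕ) (U : ℕ → Set S.Noise), (∀ i, MeasurableSet (U i)) →
        ρ₁ {ω | ∀ i < N, ω i ∈ U i} = ρ₂ {ω | ∀ i < N, ω i ∈ U i} := by
      intro N U hU
      have hE := S.measurableSet_forall_lt N hU
      rw [r1 _ hE, r2 _ hE, lintegral_congr_ae (ae_restrict_of_ae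
        (hm.measure_cylinder_inter_section hD hinv hp N U hU))]
      simp [mul_assoc]
    have hρ : ρ₁ = ρ₂ := by
      refine ext_of_generate_finite _ generateFrom_squareCylinders.symm
        (isPiSystem_squareCylinders (fun _ => MeasurableSpace.isPiSystem_measurableSet)
          fun _ => (MeasurableSet.univ : MeasurableSet (univ : Set S.Noise))) ?_ ?_
      · rintro _ ⟨s, U, hU, rfl⟩
        obtain ⟨N, hN⟩ := s.exists_nat_subset_range
        have := hcyl N (fun i => if i ∈ s then U i else univ) fun i => by
          split_ifs with hi
          exacts [hU i (mem_univ _), MeasurableSet.univ]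
        convert this using 2 <;>
        · ext ω
          simp only [Set.mem_pi, Finset.mem_coe, mem_ofPred_eq]
          constructor
          · intro h i _
            split_ifs with hi
            exacts [h i hi, mem_univ _]
          · intro h i hi
            have := h i (Finset.mem_range.1 (hN hi))
            rwa [if_pos hi] at this
      · simpa using hcyl 0 (fun _ => univ) fun _ => MeasurableSet.univ
    rw [hrect s hs, ← r1 s hs, hρ, r2 s hs, Measure.smul_apply, Measure.prod_prod, smul_eq_mul]
  have h1 := congrArg (fun ρ => ρ D) key
  simp only [Measure.restrict_apply_self, Measure.smul_apply, smul_eq_mul, hDp] at h1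
  rw [hDp]
  by_cases h0 : p = 0
  · exact Or.inl h0
  · right
    have : p * 1 = p * p := by rw [mul_one]; exact h1
    exact ((ENNReal.mul_right_inj h0 hptop).1 this).symm

/-- For a `Θ`-invariant `D`, the measure of its section at `x` is a bounded harmonic function of
`x`. Its superlevel sets are invariant for the chain, which forces it to be constant and brings in
the zero-one law. -/
lemma IsStationary.ergodic_of_not_split [IsProbabilityMeasure m] (hm : S.IsStationary m)
    (hsplit : ∀ B, MeasurableSet B → IsInvariantSet m B → m B = 0 ∨ m Bᶜ = 0) :
    Ergodic S.Θ (S.ℙ.prod m) := by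
  refine { hm.measurePreserving_Θ with aeconst_set := fun D hD hinv => ?_ }
  have hsec : ∀ x, MeasurableSet {ω | (ω, x) ∈ D} := fun x =>
    (measurable_id.prodMk measurable_const) hD
  have hhe : Measurable fun x => S.ℙ {ω | (ω, x) ∈ D} := measurable_measure_prodMk_right hD
  set h : S.X → ℝ := fun x => S.ℙ.real {ω | (ω, x) ∈ D} with hh
  have hhm : Measurable h := hhe.ennreal_toReal
  have h0 : ∀ x, ‖h x‖ ≤ 1 := fun x => by
    rw [Real.norm_of_nonneg measureReal_nonneg]; exact measureReal_le_one
  have harmE : ∀ x, ∫⁻ w, S.ℙ {ω | (ω, S.step w x) ∈ D} ∂S.noiseLaw = S.ℙ {ω | (ω, x) ∈ D} := by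
    intro x
    rw [S.measure_eq_lintegral_cons (hsec x)]
    refine lintegral_congr fun w => ?_
    congr 1
    ext ω
    change _ ↔ (S.cons w ω, x) ∈ D
    conv_rhs => rw [← hinv]
    rfl
  have harm : ∀ x, ∫ w, h (S.step w x) ∂S.noiseLaw = h x := by
    intro x
    simp only [hh, Measure.real]
    have hmw : Measurable fun w => S.ℙ {ω | (ω, S.step w x) ∈ D} :=
      hhe.comp (S.measurable_step_left x)
    rw [integral_toReal hmw.aemeasurable (Filter.Eventually.of_forall fun _ => measure_lt_top _ _),
      harmE]
  have hint : Integrable h m :=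
    Integrable.of_bound hhm.aestronglyMeasurable 1 (Filter.Eventually.of_forall h0)
  -- The superlevel set at the mean is enough: a function lying almost everywhere on one side of its
  -- mean equals it.
  set a := ∫ x, h x ∂m with ha
  have hB : MeasurableSet {x | a < h x} := measurableSet_lt measurable_const hhm
  have hBinv : IsInvariantSet m {x | a < h x} := by
    filter_upwards [hm.harmonic_step_eq hhm h0 harm] with x hx
    filter_upwards [hx] with w hw
    simp [hw]
  have hconst : ∀ᵐ x ∂m, h x = a := by
    have hc : ∫ _, a ∂m = a := by simp
    rcases hsplit _ hB hBinv with hz | hz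
    · have hle : ∀ᵐ x ∂m, h x ≤ a := by
        filter_upwards [measure_eq_zero_iff_ae_notMem.1 hz] with x hx
        exact not_lt.1 hx
      exact (integral_eq_iff_of_ae_le hint (integrable_const a) hle).1 (by rw [hc])
    · have hle : ∀ᵐ x ∂m, a ≤ h x := by
        filter_upwards [measure_eq_zero_iff_ae_notMem.1 hz] with x hx
        simp only [mem_compl_iff, mem_ofPred_eq, not_not] at hx
        exact hx.le
      filter_upwards [(integral_eq_iff_of_ae_le (integrable_const a) hint hle).1 (by rw [hc])]
        with x hx
      exact hx.symm
  have hp : ∀ᵐ x ∂m, S.ℙ {ω | (ω, x) ∈ D} = ENNReal.ofReal a := by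
    filter_upwards [hconst] with x hx
    rw [← hx, hh, ofReal_measureReal]
  rw [Filter.eventuallyConst_set]
  rcases hm.measure_eq_zero_or_one_of_const hD hinv hp with hz | hz
  · right
    exact measure_eq_zero_iff_ae_notMem.1 hz
  · left
    exact (prob_compl_eq_zero_iff hD).2 hz

end NoisySystem

end

noncomputable section

namespace NoisySystem

variable {n : ℕ} {S : NoisySystem n} {m : Measure S.X}

/-! ### Uniqueness of the stationary measure on an ergodic component -/

/-- Every stationary probability carried by `A` forces `densBound * vol A ≥ 1`. Splitting off one
invariant piece therefore lowers this quantity for the other by at least 1, and the induction on the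
integer bound `j` terminates. -/
lemma IsStationary.exists_ergodic_aux (j : ℕ) :
    ∀ (m : Measure S.X) [IsProbabilityMeasure m], S.IsStationary m →
      ∀ A, MeasurableSet A → m Aᶜ = 0 → S.densBound * S.vol A < j →
        ∃ (s : ℝ≥0∞) (m' : Measure S.X), s ≠ 0 ∧ S.IsErgodicStationary m' ∧ s • m' ≤ m := by
  induction j with
  | zero => intro m _ _ A _ _ h; simp at h
  | succ j ih =>
    intro m _ hm A hA hmA hvol
    by_cases hsplit : ∀ B, MeasurableSet B → IsInvariantSet m B → m B = 0 ∨ m Bᶜ = 0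
    · exact ⟨1, m, one_ne_zero, ⟨inferInstance, hm, hm.ergodic_of_not_split hsplit⟩, by simp⟩
    push Not at hsplit
    obtain ⟨B, hB, hinv, h1, h2⟩ := hsplit
    have hp1 : IsProbabilityMeasure ((m B)⁻¹ • m.restrict B) :=
      ⟨by simp [ENNReal.inv_mul_cancel h1 (measure_ne_top m B)]⟩
    have hp2 : IsProbabilityMeasure ((m Bᶜ)⁻¹ • m.restrict Bᶜ) :=
      ⟨by simp [ENNReal.inv_mul_cancel h2 (measure_ne_top m Bᶜ)]⟩
    have hs1 : S.IsStationary ((m B)⁻¹ • m.restrict B) := (hm.restrict hB hinv).smul _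
    have hs2 : S.IsStationary ((m Bᶜ)⁻¹ • m.restrict Bᶜ) :=
      (hm.restrict hB.compl hinv.compl).smul _
    have hcarry : ∀ B', MeasurableSet B' → m.restrict B' (A ∩ B')ᶜ = 0 := by
      intro B' hB'
      rw [Measure.restrict_apply (hA.inter hB').compl]
      refine measure_mono_null ?_ hmA
      rintro x ⟨hx, hx'⟩ hxA
      exact hx ⟨hxA, hx'⟩
    have hlow : 1 ≤ S.densBound * S.vol (A ∩ Bᶜ) := by
      have hone : ((m Bᶜ)⁻¹ • m.restrict Bᶜ) (A ∩ Bᶜ) = 1 := by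
        rw [← prob_compl_eq_zero_iff (hA.inter hB.compl), Measure.smul_apply,
          hcarry _ hB.compl, smul_zero]
      rw [← hone]
      exact hs2.le_vol _
    have hlt : S.densBound * S.vol (A ∩ B) < j := by
      have hadd : S.densBound * S.vol (A ∩ B) + S.densBound * S.vol (A ∩ Bᶜ) =
          S.densBound * S.vol A := by
        rw [← mul_add, ← measure_inter_add_sdiff A hB, sdiff_eq]
      have : S.densBound * S.vol (A ∩ B) + 1 < j + 1 := by
        calc _ ≤ _ := add_le_add_right hlow _
          _ = _ := hadd
          _ < _ := by exact_mod_cast hvol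
      exact lt_of_add_lt_add_right this
    obtain ⟨s, m', hs, hm', hle⟩ := ih _ hs1 (A ∩ B) (hA.inter hB)
      (by rw [Measure.smul_apply, hcarry B hB, smul_zero]) hlt
    refine ⟨m B * s, m', mul_ne_zero h1 hs, hm', ?_⟩
    calc (m B * s) • m' = m B • (s • m') := by rw [smul_smul]
      _ ≤ m B • ((m B)⁻¹ • m.restrict B) := by gcongr
      _ = m.restrict B := by
        rw [smul_smul, ENNReal.mul_inv_cancel h1 (measure_ne_top m B), one_smul]
      _ ≤ m := Measure.restrict_le_self

/-- Every stationary probability measure dominates a multiple of an ergodic one. -/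
lemma IsStationary.exists_ergodic [IsProbabilityMeasure m] (hm : S.IsStationary m) :
    ∃ (s : ℝ≥0∞) (m' : Measure S.X), s ≠ 0 ∧ S.IsErgodicStationary m' ∧ s • m' ≤ m := by
  have hfin : S.densBound * S.vol univ ≠ ∞ :=
    ENNReal.mul_ne_top S.densBound_ne_top (measure_ne_top _ _)
  obtain ⟨j, hj⟩ := ENNReal.exists_nat_gt hfin
  exact IsStationary.exists_ergodic_aux j m hm univ MeasurableSet.univ (by simp) hj

/-- Subtract from `m` the largest multiple of `μ` below it. A nonzero remainder would be stationary
and carried by `Y`, so it would dominate a multiple of an ergodic measure carried by `Y`. That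
measure is `μ`, contradicting maximality. -/
lemma IsErgodicComponent.eq_of_isStationary {Y : Set S.X} {μ : Measure S.X}
    (hY : S.IsErgodicComponent Y μ) [IsProbabilityMeasure m] (hm : S.IsStationary m)
    (hmY : m Yᶜ = 0) : m = μ := by
  obtain ⟨-, -, ⟨hμp, hμs, -⟩, -, huniq⟩ := hY
  set T : Set ℝ≥0∞ := {t | t • μ ≤ m} with hT
  set τ := sSup T with hτ
  have hτm : τ • μ ≤ m := by
    refine Measure.le_iff'.2 fun A => ?_
    rw [Measure.smul_apply, smul_eq_mul, hτ, sSup_eq_iSup, ENNReal.iSup_mul]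
    refine iSup_le fun t => ?_
    rw [ENNReal.iSup_mul]
    exact iSup_le fun ht => ht A
  have hτ1 : τ ≤ 1 := by
    have := hτm univ
    simpa using this
  have hτtop : τ ≠ ∞ := ne_top_of_le_ne_top ENNReal.one_ne_top hτ1
  have hτfin : IsFiniteMeasure (τ • μ) := Measure.smul_finite _ hτtop
  set r := m - τ • μ with hr
  have hadd : r + τ • μ = m := Measure.sub_add_cancel_of_le hτm
  have hrm : r ≤ m := Measure.sub_le
  have hrfin : IsFiniteMeasure r := isFiniteMeasure_of_le m hrm
  have hrs : S.IsStationary r := by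
    intro A hA
    have h1 := hm A hA
    rw [← hadd, lintegral_add_measure, ← (hμs.smul τ) A hA, Measure.add_apply] at h1
    exact (ENNReal.add_left_inj (measure_ne_top _ _)).1 h1
  by_cases hr0 : r univ = 0
  · rw [Measure.measure_univ_eq_zero.1 hr0, zero_add] at hadd
    have : τ = 1 := by
      have := congrArg (fun ρ => ρ univ) hadd
      simpa using this
    rw [← hadd, this, one_smul]
  exfalso
  have hrp : IsProbabilityMeasure ((r univ)⁻¹ • r) :=
    ⟨by simp [ENNReal.inv_mul_cancel hr0 (measure_ne_top r univ)]⟩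
  obtain ⟨s, m', hs, hm', hle⟩ := (hrs.smul (r univ)⁻¹).exists_ergodic
  have hm'Y : m' Yᶜ = 0 := by
    have h1 : s * m' Yᶜ ≤ (r univ)⁻¹ * r Yᶜ := hle Yᶜ
    have h2 : r Yᶜ = 0 := le_antisymm ((hrm Yᶜ).trans_eq hmY) zero_le
    rw [h2, mul_zero] at h1
    exact (mul_eq_zero.1 (le_antisymm h1 zero_le)).resolve_left hs
  obtain rfl := huniq m' hm' hm'Y
  have hle' : (r univ * s) • m' ≤ r := by
    calc (r univ * s) • m' = r univ • (s • m') := by rw [smul_smul]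
      _ ≤ r univ • ((r univ)⁻¹ • r) := by gcongr
      _ = r := by rw [smul_smul, ENNReal.mul_inv_cancel hr0 (measure_ne_top _ _), one_smul]
  have hmem : r univ * s + τ ∈ T := by
    change (r univ * s + τ) • m' ≤ m
    rw [add_smul]
    exact (add_le_add_left hle' _).trans_eq hadd
  have hcon : r univ * s + τ ≤ 0 + τ := by
    rw [zero_add]
    exact le_sSup hmem
  have := (ENNReal.add_le_add_iff_right hτtop).1 hcon
  exact mul_ne_zero hr0 hs (le_antisymm this zero_le)

end NoisySystem

end

noncomputable section

/-! ### Setwise limits of dominated measures along an ultrafilter -/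

section SetwiseLimit

open Filter Topology

variable {α ι : Type*} [MeasurableSpace α]

/-- Limits along an ultrafilter exist because `[0, ∞]` is compact, and they are finitely additive.
Domination by the finite `ρ` makes tails of disjoint unions small, which upgrades this to countable
additivity. -/
lemma exists_measure_setwise_tendsto (U : Ultrafilter ι) (ρ : Measure α) [IsFiniteMeasure ρ]
    (ms : ι → Measure α) (hms : ∀ i, ms i ≤ ρ) :
    ∃ m : Measure α, m ≤ ρ ∧
      ∀ A, MeasurableSet A → Tendsto (fun i => ms i A) U (𝓝 (m A)) := by
  have hL : ∀ A : Set α, ∃ a : ℝ≥0∞, Tendsto (fun i => ms i A) U (𝓝 a) := fun A => by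
    obtain ⟨a, -, ha⟩ := isCompact_univ.ultrafilter_le_nhds (U.map fun i => ms i A) (by simp)
    exact ⟨a, ha⟩
  choose L hL using hL
  have hLle : ∀ A, L A ≤ ρ A := fun A =>
    le_of_tendsto (hL A) (Eventually.of_forall fun i => hms i A)
  have hempty : L ∅ = 0 := le_antisymm ((hLle ∅).trans_eq measure_empty) zero_le
  have hadd : ∀ A B, MeasurableSet B → Disjoint A B → L (A ∪ B) = L A + L B := by
    intro A B hB hAB
    refine tendsto_nhds_unique (hL (A ∪ B)) (((hL A).add (hL B)).congr fun i => ?_)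
    exact (measure_union hAB hB).symm
  have hunion : ∀ ⦃f : ℕ → Set α⦄, (∀ i, MeasurableSet (f i)) →
      Pairwise (Function.onFun Disjoint f) →
      L (⋃ i, f i) = ∑' i, L (f i) := by
    intro f hf hd
    set tail : ℕ → Set α := fun k => ⋃ i, f (i + k) with htail
    have htm : ∀ k, MeasurableSet (tail k) := fun k => MeasurableSet.iUnion fun i => hf _
    have hsucc : ∀ k, tail k = tail (k + 1) ∪ f k := by
      intro k
      ext x
      simp only [htail, mem_iUnion, mem_union]
      constructor
      · rintro ⟨i, hi⟩
        cases i with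
        | zero => right; simpa using hi
        | succ i => left; exact ⟨i, by rwa [add_right_comm] at hi⟩
      · rintro (⟨i, hi⟩ | hi)
        · exact ⟨i + 1, by rwa [add_right_comm]⟩
        · exact ⟨0, by simpa using hi⟩
    have hdisj : ∀ k, Disjoint (tail (k + 1)) (f k) := by
      intro k
      rw [htail, disjoint_iUnion_left]
      exact fun i => hd (by omega)
    have hsum : ∀ k, L (⋃ i, f i) = ∑ i ∈ Finset.range k, L (f i) + L (tail k) := by
      intro k
      induction k with
      | zero => simp [htail]
      | succ k ih =>
        rw [ih, Finset.sum_range_succ, hsucc k, hadd _ _ (hf k) (hdisj k), add_assoc,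
          add_comm (L (f k))]
    have htend : Tendsto (fun k => L (tail k)) atTop (𝓝 0) := by
      refine tendsto_of_tendsto_of_tendsto_of_le_of_le tendsto_const_nhds
        (?_ : Tendsto (fun k => ρ (tail k)) atTop (𝓝 0)) (fun _ => zero_le) fun k => hLle _
      have hinter : ⋂ k, tail k = ∅ := by
        refine eq_empty_of_forall_notMem fun x hx => ?_
        rw [mem_iInter] at hx
        obtain ⟨i, hi⟩ := mem_iUnion.1 (hx 0)
        obtain ⟨j, hj⟩ := mem_iUnion.1 (hx (i + 1))
        exact (hd (show i + 0 ≠ j + (i + 1) by omega)).notMem_of_mem_left hi hj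
      have hanti : Antitone tail := antitone_nat_of_succ_le fun k => by
        rw [hsucc k]; exact subset_union_left
      have := tendsto_measure_iInter_atTop (μ := ρ) (fun k => (htm k).nullMeasurableSet) hanti
        ⟨0, measure_ne_top _ _⟩
      rwa [hinter, measure_empty] at this
    have h1 : Tendsto (fun k => ∑ i ∈ Finset.range k, L (f i) + L (tail k)) atTop
        (𝓝 (∑' i, L (f i) + 0)) := (ENNReal.tendsto_nat_tsum _).add htend
    rw [add_zero] at h1
    exact tendsto_nhds_unique (tendsto_const_nhds.congr hsum) h1
  refine ⟨Measure.ofMeasurable (fun A _ => L A) hempty fun f hf hd => hunion hf hd, ?_, ?_⟩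
  · refine Measure.le_iff.2 fun A hA => ?_
    rw [Measure.ofMeasurable_apply A hA]
    exact hLle A
  · intro A hA
    rw [Measure.ofMeasurable_apply A hA]
    exact hL A

/-- Integration against any measure below `ρ` is 1-Lipschitz on L¹(ρ), uniformly in the index, so
convergence passes from indicators to all of L¹(ρ), unbounded functions included. -/
lemma tendsto_integral_of_setwise_tendsto {l : Filter ι} {ρ m : Measure α} [IsFiniteMeasure ρ]
    {ms : ι → Measure α} (hms : ∀ i, ms i ≤ ρ) (hm : m ≤ ρ)
    (h : ∀ A, MeasurableSet A → Tendsto (fun i => ms i A) l (𝓝 (m A))) {g : α → ℝ}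
    (hg : Integrable g ρ) : Tendsto (fun i => ∫ x, g x ∂(ms i)) l (𝓝 (∫ x, g x ∂m)) := by
  have hfin : ∀ i, IsFiniteMeasure (ms i) := fun i => isFiniteMeasure_of_le ρ (hms i)
  have hmfin : IsFiniteMeasure m := isFiniteMeasure_of_le ρ hm
  have hdist : ∀ {m' : Measure α}, m' ≤ ρ → ∀ f f' : α →₁[ρ] ℝ,
      dist (∫ x, f x ∂m') (∫ x, f' x ∂m') ≤ dist f f' := by
    intro m' hm' f f'
    have i1 := (L1.integrable_coeFn f).mono_measure hm'
    have i2 := (L1.integrable_coeFn f').mono_measure hm'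
    rw [dist_eq_norm, ← integral_sub i1 i2, L1.dist_eq_integral_dist]
    refine (norm_integral_le_integral_norm _).trans ?_
    refine integral_mono_measure hm' (Eventually.of_forall fun x => norm_nonneg _) ?_
    exact ((L1.integrable_coeFn f).sub (L1.integrable_coeFn f')).norm
  refine Integrable.induction (μ := ρ)
    (fun g => Tendsto (fun i => ∫ x, g x ∂(ms i)) l (𝓝 (∫ x, g x ∂m))) ?_ ?_ ?_ ?_ hg
  · intro c s hs _
    simp only [integral_indicator_const _ hs, smul_eq_mul]
    exact ((ENNReal.tendsto_toReal (measure_ne_top m s)).comp (h s hs)).mul_const c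
  · intro f g _ hf hg hf' hg'
    simp only [Pi.add_apply]
    rw [integral_add (hf.mono_measure hm) (hg.mono_measure hm)]
    refine (hf'.add hg').congr fun i => ?_
    rw [integral_add (hf.mono_measure (hms i)) (hg.mono_measure (hms i))]
  · refine isClosed_of_closure_subset fun f hf => ?_
    refine Metric.tendsto_nhds.2 fun ε hε => ?_
    obtain ⟨f', hf', hff'⟩ := Metric.mem_closure_iff.1 hf (ε / 3) (by positivity)
    filter_upwards [Metric.tendsto_nhds.1 hf' (ε / 3) (by positivity)] with i hi
    calc dist (∫ x, f x ∂(ms i)) (∫ x, f x ∂m)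
        ≤ dist (∫ x, f x ∂(ms i)) (∫ x, f' x ∂(ms i)) +
          dist (∫ x, f' x ∂(ms i)) (∫ x, f' x ∂m) + dist (∫ x, f' x ∂m) (∫ x, f x ∂m) :=
          dist_triangle4 _ _ _ _
      _ < ε := by
        have a := hdist (hms i) f f'
        have b := hdist hm f' f
        rw [dist_comm] at b
        rw [dist_comm f' f] at b
        rw [dist_comm (∫ x, f' x ∂m)]
        linarith
  · intro f g hfg _ hf
    have e1 : ∫ x, g x ∂m = ∫ x, f x ∂m :=
      integral_congr_ae ((Measure.absolutelyContinuous_of_le hm).ae_eq hfg.symm)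
    rw [e1]
    refine hf.congr fun i => ?_
    exact integral_congr_ae ((Measure.absolutelyContinuous_of_le (hms i)).ae_eq hfg)

end SetwiseLimit

namespace NoisySystem

open Filter Topology

variable {n : ℕ} {S : NoisySystem n}

/-! ### Uniform convergence of the mean time averages -/

instance (k : ℕ) (x : S.X) : IsProbabilityMeasure (S.ℙ.map fun ω => S.iter k ω x) :=
  Measure.isProbabilityMeasure_map (S.measurable_iter_left k x).aemeasurable

variable (S) in
/-- The average of the laws of the chain started at `x` at the times `1, …, N`. -/
def avgLaw (N : ℕ) (x : S.X) : Measure S.X :=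
  (N : ℝ≥0∞)⁻¹ • ∑ i ∈ Finset.range N, S.ℙ.map fun ω => S.iter (i + 1) ω x

lemma avgLaw_le (N : ℕ) (x : S.X) : S.avgLaw N x ≤ S.densBound • S.vol := by
  refine Measure.le_iff'.2 fun A => ?_
  rw [avgLaw, Measure.smul_apply, Measure.finsetSum_apply, smul_eq_mul]
  calc _ ≤ (N : ℝ≥0∞)⁻¹ * ∑ _i ∈ Finset.range N, (S.densBound • S.vol) A := by
        exact mul_le_mul_right (Finset.sum_le_sum fun i _ => S.map_iter_succ_le i x A) _
    _ = (N : ℝ≥0∞)⁻¹ * N * (S.densBound • S.vol) A := by simp [mul_assoc]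
    _ ≤ 1 * (S.densBound • S.vol) A := by gcongr; exact ENNReal.inv_mul_le_one _
    _ = _ := one_mul _

lemma avgLaw_univ {N : ℕ} (hN : N ≠ 0) (x : S.X) : S.avgLaw N x univ = 1 := by
  rw [avgLaw, Measure.smul_apply, Measure.finsetSum_apply, smul_eq_mul]
  simp only [measure_univ, Finset.sum_const, Finset.card_range, nsmul_eq_mul, mul_one]
  exact ENNReal.inv_mul_cancel (by exact_mod_cast hN) (ENNReal.natCast_ne_top N)

lemma integrable_iter_succ {φ : S.X → ℝ} (hφ : Integrable φ S.vol) (k : ℕ) (x : S.X) :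
    Integrable φ (S.ℙ.map fun ω => S.iter (k + 1) ω x) :=
  (hφ.smul_measure S.densBound_ne_top).mono_measure (S.map_iter_succ_le k x)

lemma integral_avgLaw {φ : S.X → ℝ} (hφm : Measurable φ) (hφ : Integrable φ S.vol) (N : ℕ)
    (x : S.X) :
    ∫ y, φ y ∂(S.avgLaw N x) =
      (N : ℝ)⁻¹ * ∑ i ∈ Finset.range N, ∫ ω, φ (S.iter (i + 1) ω x) ∂S.ℙ := by
  rw [avgLaw, integral_smul_measure, integral_finsetSum_measure fun i _ =>
    integrable_iter_succ hφ i x]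
  simp only [ENNReal.toReal_inv, ENNReal.toReal_natCast, smul_eq_mul]
  congr 1
  exact Finset.sum_congr rfl fun i _ =>
    integral_map (S.measurable_iter_left _ x).aemeasurable hφm.aestronglyMeasurable

lemma IsErgodicComponent.ae_step {Y : Set S.X} {μ : Measure S.X} (hY : S.IsErgodicComponent Y μ)
    {x : S.X} (hx : x ∈ Y) : ∀ᵐ w ∂S.noiseLaw, S.step w x ∈ Y := by
  have h := hY.2.1 x hx
  rw [← S.map_cons] at h
  have h2 := ae_of_ae_map S.measurable_cons.aemeasurable h
  have h3 := Measure.ae_ae_of_ae_prod h2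
  filter_upwards [h3] with w hw
  obtain ⟨ω, hω⟩ := hw.exists
  exact hω

lemma IsErgodicComponent.ae_iter {Y : Set S.X} {μ : Measure S.X} (hY : S.IsErgodicComponent Y μ)
    {x : S.X} (hx : x ∈ Y) (k : ℕ) : ∀ᵐ ω ∂S.ℙ, S.iter k ω x ∈ Y := by
  have hYm : MeasurableSet Yᶜ := hY.1.compl
  cases k with
  | zero => exact Eventually.of_forall fun _ => hx
  | succ k =>
    induction k with
    | zero => exact hY.2.1 x hx
    | succ k ih =>
      have h := S.lintegral_iter_succ (k + 1) x (Yᶜ.indicator 1) (measurable_one.indicator hYm)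
      have h0 : ∫⁻ ω, ∫⁻ w, Yᶜ.indicator (1 : S.X → ℝ≥0∞) (S.step w (S.iter (k + 1) ω x))
          ∂S.noiseLaw ∂S.ℙ = 0 := by
        rw [lintegral_congr_ae (g := fun _ => 0) ?_, lintegral_zero]
        filter_upwards [ih] with ω hω
        rw [lintegral_congr_ae (g := fun _ => 0) ?_, lintegral_zero]
        filter_upwards [hY.ae_step hω] with w hw
        simp [hw]
      have hmeas : Measurable fun ω => Yᶜ.indicator (1 : S.X → ℝ≥0∞) (S.iter (k + 2) ω x) :=
        (measurable_one.indicator hYm).comp (S.measurable_iter_left (k + 2) x)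
      rw [h0, lintegral_eq_zero_iff hmeas] at h
      filter_upwards [h] with ω hω
      by_contra hc
      simp [hc] at hω

/-- Averaged laws are almost stationary: one step shifts the time window, and the sums telescope to
two boundary terms. -/
lemma abs_integral_step_avgLaw_sub_le {A : Set S.X} (hA : MeasurableSet A) {N : ℕ} (hN : N ≠ 0)
    (x : S.X) :
    |∫ y, S.noiseLaw.real {w | S.step w y ∈ A} ∂(S.avgLaw N x) - (S.avgLaw N x).real A| ≤
      (N : ℝ)⁻¹ := by
  have hN0 : (0 : ℝ) < N := by exact_mod_cast Nat.pos_of_ne_zero hN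
  have hgE : Measurable fun y => S.noiseLaw {w | S.step w y ∈ A} :=
    measurable_measure_prodMk_right (S.measurable_step hA)
  have hg : Measurable fun y => S.noiseLaw.real {w | S.step w y ∈ A} := hgE.ennreal_toReal
  have hgi : Integrable (fun y => S.noiseLaw.real {w | S.step w y ∈ A}) S.vol := by
    refine Integrable.of_bound hg.aestronglyMeasurable 1 (Eventually.of_forall fun y => ?_)
    rw [Real.norm_of_nonneg measureReal_nonneg]
    exact measureReal_le_one
  set p : ℕ → ℝ := fun i => S.ℙ.real {ω | S.iter i ω x ∈ A} with hp
  have hstep : ∀ i, ∫ ω, S.noiseLaw.real {w | S.step w (S.iter i ω x) ∈ A} ∂S.ℙ = p (i + 1) := by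
    intro i
    have h := S.lintegral_iter_succ i x (A.indicator 1) (measurable_one.indicator hA)
    have hA1 : MeasurableSet {ω | S.iter (i + 1) ω x ∈ A} := S.measurable_iter_left _ x hA
    have e1 : ∀ ω, A.indicator (1 : S.X → ℝ≥0∞) (S.iter (i + 1) ω x) =
        ({ω | S.iter (i + 1) ω x ∈ A} : Set S.Ω).indicator 1 ω := fun ω => rfl
    have e2 : ∀ y, ∫⁻ w, A.indicator (1 : S.X → ℝ≥0∞) (S.step w y) ∂S.noiseLaw =
        S.noiseLaw {w | S.step w y ∈ A} := fun y => by
      have hA2 : MeasurableSet {w | S.step w y ∈ A} := S.measurable_step_left y hA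
      rw [← lintegral_indicator_one hA2]
      rfl
    simp only [e1, e2] at h
    rw [lintegral_indicator_one hA1] at h
    have hgi' : Measurable fun ω => S.noiseLaw {w | S.step w (S.iter i ω x) ∈ A} :=
      hgE.comp (S.measurable_iter_left i x)
    simp only [Measure.real]
    rw [integral_toReal hgi'.aemeasurable (Eventually.of_forall fun _ => measure_lt_top _ _), ← h]
    rfl
  have hav : (S.avgLaw N x).real A = (N : ℝ)⁻¹ * ∑ i ∈ Finset.range N, p (i + 1) := by
    have h1 : Measurable (A.indicator (1 : S.X → ℝ)) := measurable_one.indicator hA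
    have h2 : Integrable (A.indicator (1 : S.X → ℝ)) S.vol :=
      (integrable_indicator_iff hA).2 (integrableOn_const (measure_ne_top _ _))
    rw [← integral_indicator_one hA, integral_avgLaw h1 h2]
    congr 1
    refine Finset.sum_congr rfl fun i _ => ?_
    have hA1 : MeasurableSet {ω | S.iter (i + 1) ω x ∈ A} := S.measurable_iter_left _ x hA
    exact integral_indicator_one hA1
  rw [integral_avgLaw hg hgi, hav]
  simp only [hstep]
  rw [← mul_sub, ← Finset.sum_sub_distrib, Finset.sum_range_sub (fun i => p (i + 1)), abs_mul,
    abs_of_pos (inv_pos.2 hN0)]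
  have hp01 : ∀ i, 0 ≤ p i ∧ p i ≤ 1 := fun i => ⟨measureReal_nonneg, measureReal_le_one⟩
  have : |p (N + 1) - p (0 + 1)| ≤ 1 := by
    rw [abs_le]
    constructor <;> linarith [(hp01 (N + 1)).1, (hp01 (N + 1)).2, (hp01 (0 + 1)).1,
      (hp01 (0 + 1)).2]
  calc (N : ℝ)⁻¹ * |p (N + 1) - p (0 + 1)| ≤ (N : ℝ)⁻¹ * 1 := by gcongr
    _ = _ := mul_one _

/-- On an ergodic component, the mean time averages of an integrable function are eventually at
most its space average, uniformly in the starting point. -/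
lemma IsErgodicComponent.exists_sum_integral_iter_le {Y : Set S.X} {μ : Measure S.X}
    (hY : S.IsErgodicComponent Y μ) {φ : S.X → ℝ} (hφm : Measurable φ)
    (hφ : Integrable φ S.vol) {ε : ℝ} (hε : 0 < ε) :
    ∃ N : ℕ, 0 < N ∧ ∀ x ∈ Y,
      ∑ i ∈ Finset.range N, ∫ ω, φ (S.iter (i + 1) ω x) ∂S.ℙ ≤ N * (∫ y, φ y ∂μ + ε) := by
  by_contra! hcon
  choose! xs hxs hgt using fun N : ℕ => hcon (N + 1) (Nat.succ_pos N)
  set U : Ultrafilter ℕ := Ultrafilter.of atTop with hU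
  have hUle : (U : Filter ℕ) ≤ atTop := Ultrafilter.of_le atTop
  set ms : ℕ → Measure S.X := fun N => S.avgLaw (N + 1) (xs N) with hms
  have hρ : IsFiniteMeasure (S.densBound • S.vol) := Measure.smul_finite _ S.densBound_ne_top
  have hmsle : ∀ N, ms N ≤ S.densBound • S.vol := fun N => avgLaw_le _ _
  obtain ⟨m, hmle, hm⟩ := exists_measure_setwise_tendsto U (S.densBound • S.vol) ms hmsle
  have hint : ∀ {g : S.X → ℝ}, Integrable g S.vol →
      Tendsto (fun N => ∫ x, g x ∂(ms N)) U (𝓝 (∫ x, g x ∂m)) := fun hg =>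
    tendsto_integral_of_setwise_tendsto hmsle hmle hm (hg.smul_measure S.densBound_ne_top)
  have hmp : IsProbabilityMeasure m := ⟨by
    refine tendsto_nhds_unique (hm univ MeasurableSet.univ) (tendsto_const_nhds.congr fun N => ?_)
    exact (avgLaw_univ (Nat.succ_ne_zero N) _).symm⟩
  have hmY : m Yᶜ = 0 := by
    refine tendsto_nhds_unique (hm _ hY.1.compl) (tendsto_const_nhds.congr fun N => ?_)
    symm
    simp only [hms, avgLaw, Measure.smul_apply, Measure.finsetSum_apply, smul_eq_mul]
    rw [Finset.sum_eq_zero, mul_zero]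
    intro i _
    rw [Measure.map_apply (S.measurable_iter_left _ _) hY.1.compl]
    exact measure_eq_zero_iff_ae_notMem.2 (by
      filter_upwards [hY.ae_iter (hxs N) (i + 1)] with ω hω
      simpa using hω)
  have hms' : S.IsStationary m := by
    refine isStationary_of_measure_step fun A hA => ?_
    have hgE : Measurable fun y => S.noiseLaw {w | S.step w y ∈ A} :=
      measurable_measure_prodMk_right (S.measurable_step hA)
    have hg : Measurable fun y => S.noiseLaw.real {w | S.step w y ∈ A} := hgE.ennreal_toReal
    have hgi : Integrable (fun y => S.noiseLaw.real {w | S.step w y ∈ A}) S.vol := by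
      refine Integrable.of_bound hg.aestronglyMeasurable 1 (Eventually.of_forall fun y => ?_)
      rw [Real.norm_of_nonneg measureReal_nonneg]
      exact measureReal_le_one
    have t1 := hint hgi
    have t2 : Tendsto (fun N => (ms N).real A) U (𝓝 (m.real A)) :=
      (ENNReal.tendsto_toReal (measure_ne_top m A)).comp (hm A hA)
    have t3 : Tendsto (fun N => ∫ y, S.noiseLaw.real {w | S.step w y ∈ A} ∂(ms N) -
        (ms N).real A) U (𝓝 0) := by
      refine squeeze_zero_norm (fun N => abs_integral_step_avgLaw_sub_le hA (Nat.succ_ne_zero N)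
        (xs N)) ?_
      exact ((tendsto_inv_atTop_nhds_zero_nat (𝕜 := ℝ)).comp (tendsto_add_atTop_nat 1)).mono_left
        hUle
    have e := tendsto_nhds_unique (t1.sub t2) t3
    have e' : ∫ y, S.noiseLaw.real {w | S.step w y ∈ A} ∂m = m.real A := by linarith
    simp only [Measure.real] at e'
    rw [integral_toReal hgE.aemeasurable (Eventually.of_forall fun _ => measure_lt_top _ _)] at e'
    refine (ENNReal.toReal_eq_toReal_iff' ?_ (measure_ne_top _ _)).1 e'
    refine ne_top_of_le_ne_top ENNReal.one_ne_top ?_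
    calc _ ≤ ∫⁻ _, 1 ∂m := lintegral_mono fun y => prob_le_one
      _ = 1 := by simp
  -- The limit is stationary and lives on `Y`, so it is `μ`; the averages of `φ` then converge to
  -- its `μ`-mean, although each exceeds that by `ε`.
  have hmμ := hY.eq_of_isStationary hms' hmY
  have hlim := hint hφ
  rw [hmμ] at hlim
  have hge : ∫ y, φ y ∂μ + ε ≤ ∫ y, φ y ∂μ := by
    refine ge_of_tendsto hlim (Eventually.of_forall fun N => ?_)
    simp only [hms]
    rw [integral_avgLaw hφm hφ]
    have hpos : (0 : ℝ) < ((N + 1 : ℕ) : ℝ) := by positivity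
    rw [← inv_mul_cancel_left₀ hpos.ne' (∫ y, φ y ∂μ + ε)]
    exact mul_le_mul_of_nonneg_left (hgt N).le (inv_nonneg.2 hpos.le)
  linarith

end NoisySystem

end

noncomputable section

/-! ### Second-order bounds for the exponential. -/

lemma Real.exp_le_one_add_add_sq_mul_exp_abs (u : ℝ) :
    Real.exp u ≤ 1 + u + u ^ 2 * Real.exp |u| := by
  have h1 : (1 : ℝ) ≤ Real.exp |u| := Real.one_le_exp (abs_nonneg u)
  have h2 : u ^ 2 ≤ u ^ 2 * Real.exp |u| := le_mul_of_one_le_right (sq_nonneg u) h1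
  by_cases hu : |u| ≤ 1
  · have := (abs_le.1 (Real.abs_exp_sub_one_sub_id_le hu)).2
    linarith
  · rw [not_le] at hu
    rcases le_or_gt 0 u with h0 | h0
    · rw [abs_of_nonneg h0] at hu h1 ⊢
      have : Real.exp u ≤ u ^ 2 * Real.exp u :=
        le_mul_of_one_le_left (Real.exp_pos u).le (by nlinarith)
      linarith
    · have he : Real.exp u ≤ 1 := Real.exp_le_one_iff.2 h0.le
      rw [abs_of_neg h0] at hu
      nlinarith

/-- Half of the exponent `s` absorbs `u²` (whence 8 / s², from x²/2 ≤ eˣ at x = s|u|/2), the other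
half absorbs `exp |t * u|`. -/
lemma Real.exp_mul_le_of_small {s t u v : ℝ} (hs : 0 < s) (ht : 0 ≤ t) (hts : t ≤ s / 2)
    (huv : |u| ≤ v) :
    Real.exp (t * u) ≤ 1 + t * u + t ^ 2 * (8 / s ^ 2 * Real.exp (s * v)) := by
  refine (Real.exp_le_one_add_add_sq_mul_exp_abs (t * u)).trans ?_
  have h1 : u ^ 2 ≤ 8 / s ^ 2 * Real.exp (s / 2 * |u|) := by
    have := Real.quadratic_le_exp_of_nonneg (x := s / 2 * |u|) (by positivity)
    have h0 : 0 ≤ s / 2 * |u| := by positivity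
    rw [div_mul_eq_mul_div, le_div_iff₀ (by positivity)]
    have h3 : u ^ 2 = |u| ^ 2 := (sq_abs u).symm
    rw [h3]
    nlinarith
  have h2 : Real.exp |t * u| ≤ Real.exp (s / 2 * |u|) := by
    rw [abs_mul, abs_of_nonneg ht]
    gcongr
  have h3 : Real.exp (s / 2 * |u|) * Real.exp (s / 2 * |u|) ≤ Real.exp (s * v) := by
    rw [← Real.exp_add]
    refine Real.exp_le_exp.2 ?_
    nlinarith
  have h4 : (t * u) ^ 2 * Real.exp |t * u| ≤ t ^ 2 * (8 / s ^ 2 * Real.exp (s * v)) := by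
    calc (t * u) ^ 2 * Real.exp |t * u| = t ^ 2 * (u ^ 2 * Real.exp |t * u|) := by ring
      _ ≤ t ^ 2 * ((8 / s ^ 2 * Real.exp (s / 2 * |u|)) * Real.exp (s / 2 * |u|)) := by gcongr
      _ = t ^ 2 * (8 / s ^ 2 * (Real.exp (s / 2 * |u|) * Real.exp (s / 2 * |u|))) := by ring
      _ ≤ _ := by gcongr
  linarith

namespace NoisySystem

open Filter Topology

variable {n : ℕ} {S : NoisySystem n}

/-! ### Exponential moments of Birkhoff sums -/

/-- The Birkhoff sum at the times `1, …, k`. -/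
def birkhoff (S : NoisySystem n) (φ : S.X → ℝ) (k : ℕ) (ω : S.Ω) (x : S.X) : ℝ :=
  ∑ i ∈ Finset.range k, φ (S.iter (i + 1) ω x)

/-- The exponential moment of the Birkhoff sum. -/
def expMoment (S : NoisySystem n) (φ : S.X → ℝ) (k : ℕ) (x : S.X) : ℝ≥0∞ :=
  ∫⁻ ω, ENNReal.ofReal (Real.exp (S.birkhoff φ k ω x)) ∂S.ℙ

variable {φ ψ : S.X → ℝ}

lemma measurable_birkhoff (hφ : Measurable φ) (k : ℕ) (x : S.X) :
    Measurable fun ω => S.birkhoff φ k ω x :=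
  Finset.measurable_sum _ fun i _ => hφ.comp (S.measurable_iter_left (i + 1) x)

lemma birkhoff_cons (k : ℕ) (w : S.Noise) (ω : S.Ω) (x : S.X) :
    S.birkhoff φ (k + 1) (S.cons w ω) x = φ (S.step w x) + S.birkhoff φ k ω (S.step w x) := by
  simp only [birkhoff, iter_cons]
  rw [Finset.sum_range_succ', add_comm]
  rfl

@[simp] lemma expMoment_zero (x : S.X) : S.expMoment φ 0 x = 1 := by
  simp [expMoment, birkhoff]

lemma expMoment_succ (hφ : Measurable φ) (k : ℕ) (x : S.X) :
    S.expMoment φ (k + 1) x = ∫⁻ w, ENNReal.ofReal (Real.exp (φ (S.step w x))) *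
      S.expMoment φ k (S.step w x) ∂S.noiseLaw := by
  rw [expMoment, S.lintegral_cons _ (measurable_birkhoff hφ (k + 1) x).exp.ennreal_ofReal]
  refine lintegral_congr fun w => ?_
  rw [expMoment, ← lintegral_const_mul _ (measurable_birkhoff hφ k _).exp.ennreal_ofReal]
  refine lintegral_congr fun ω => ?_
  rw [birkhoff_cons, Real.exp_add, ENNReal.ofReal_mul (Real.exp_pos _).le]

lemma measurable_exp_step (hφ : Measurable φ) (x : S.X) :
    Measurable fun w => ENNReal.ofReal (Real.exp (φ (S.step w x))) :=
  (hφ.comp (S.measurable_step_left x)).exp.ennreal_ofReal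

/-- Whatever the current position, the density bound makes each step cost at most the same factor.
-/
lemma expMoment_le_pow (hφ : Measurable φ) (k : ℕ) (x : S.X) :
    S.expMoment φ k x ≤
      (S.densBound * ∫⁻ y, ENNReal.ofReal (Real.exp (φ y)) ∂S.vol) ^ k := by
  induction k generalizing x with
  | zero => simp
  | succ k ih =>
    rw [expMoment_succ hφ, pow_succ']
    calc _ ≤ ∫⁻ w, ENNReal.ofReal (Real.exp (φ (S.step w x))) *
          (S.densBound * ∫⁻ y, ENNReal.ofReal (Real.exp (φ y)) ∂S.vol) ^ k ∂S.noiseLaw := by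
          gcongr; exact ih _
      _ = _ := lintegral_mul_const _ (measurable_exp_step hφ x)
      _ ≤ _ := mul_le_mul_left (S.lintegral_step_le x _ hφ.exp.ennreal_ofReal) _

/-- Since the chain stays in `Y` almost surely, a bound on the last `k` steps valid only from `Y`
may be applied after the first `j`. -/
lemma IsErgodicComponent.expMoment_add_le {Y : Set S.X} {μ : Measure S.X}
    (hY : S.IsErgodicComponent Y μ) (hφ : Measurable φ) {k : ℕ} {b : ℝ≥0∞}
    (hb : ∀ y ∈ Y, S.expMoment φ k y ≤ b) (j : ℕ) :
    ∀ x ∈ Y, S.expMoment φ (j + k) x ≤ S.expMoment φ j x * b := by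
  induction j with
  | zero => intro x hx; simpa using hb x hx
  | succ j ih =>
    intro x hx
    rw [add_right_comm, expMoment_succ hφ, expMoment_succ hφ]
    calc _ ≤ ∫⁻ w, ENNReal.ofReal (Real.exp (φ (S.step w x))) *
          S.expMoment φ j (S.step w x) * b ∂S.noiseLaw := by
          refine lintegral_mono_ae ?_
          filter_upwards [hY.ae_step hx] with w hw
          rw [mul_assoc]
          gcongr
          exact ih _ hw
      _ = _ := by
          refine lintegral_mul_const _ ((measurable_exp_step hφ x).mul ?_)
          have : Measurable fun y => S.expMoment φ j y := by
            refine Measurable.lintegral_prod_left'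
              (f := fun p : S.Ω × S.X => ENNReal.ofReal (Real.exp (S.birkhoff φ j p.1 p.2))) ?_
            refine Measurable.ennreal_ofReal (Measurable.exp ?_)
            exact Finset.measurable_sum _ fun i _ => hφ.comp (S.measurable_iter (i + 1))
          exact this.comp (S.measurable_step_left x)

lemma IsErgodicComponent.expMoment_mul_le {Y : Set S.X} {μ : Measure S.X}
    (hY : S.IsErgodicComponent Y μ) (hφ : Measurable φ) {N : ℕ} {b : ℝ≥0∞}
    (hb : ∀ y ∈ Y, S.expMoment φ N y ≤ b) (q : ℕ) :
    ∀ x ∈ Y, S.expMoment φ (q * N) x ≤ b ^ q := by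
  induction q with
  | zero => intro x _; simp
  | succ q ih =>
    intro x hx
    rw [add_mul, one_mul, pow_succ]
    exact (hY.expMoment_add_le hφ hb _ x hx).trans (mul_le_mul_left (ih x hx) _)

/-- A one-sided large deviation estimate, uniform in the starting point. -/
lemma IsErgodicComponent.large_deviation {Y : Set S.X} {μ : Measure S.X}
    (hY : S.IsErgodicComponent Y μ) (hφ : Measurable φ) {s : ℝ} (hs : 0 < s)
    (hexp : ∫⁻ y, ENNReal.ofReal (Real.exp (s * |φ y|)) ∂S.vol ≠ ∞) {ε : ℝ} (hε : 0 < ε)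
    (K : ℝ) :
    ∃ C γ : ℝ, 0 < C ∧ 0 < γ ∧ γ < 1 ∧ ∀ x ∈ Y, ∀ k : ℕ,
      S.ℙ {ω | k * (∫ y, φ y ∂μ + ε) - K ≤ S.birkhoff φ k ω x} ≤ ENNReal.ofReal (C * γ ^ k) := by
  have hint : Integrable φ S.vol := by
    have h1 : Integrable (fun y => Real.exp (s * |φ y|)) S.vol := by
      refine ⟨(hφ.abs.const_mul s).exp.aestronglyMeasurable, ?_⟩
      rw [hasFiniteIntegral_iff_ofReal (Eventually.of_forall fun y => (Real.exp_pos _).le)]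
      exact lt_top_iff_ne_top.2 hexp
    refine (h1.const_mul s⁻¹).mono' hφ.aestronglyMeasurable (Eventually.of_forall fun y => ?_)
    rw [Real.norm_eq_abs, ← div_eq_inv_mul, le_div_iff₀ hs]
    linarith [Real.add_one_le_exp (s * |φ y|)]
  set a := ∫ y, φ y ∂μ with ha
  set ψ : S.X → ℝ := fun y => s * |φ y| with hψ
  have hψm : Measurable ψ := hφ.abs.const_mul s
  set L : ℝ≥0∞ := S.densBound * ∫⁻ y, ENNReal.ofReal (Real.exp (ψ y)) ∂S.vol with hL
  have hLtop : L ≠ ∞ := ENNReal.mul_ne_top S.densBound_ne_top hexp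
  obtain ⟨N, hN, hmean⟩ := hY.exists_sum_integral_iter_le hφ hint (ε := ε / 3) (by positivity)
  have hN0 : (0 : ℝ) < N := by exact_mod_cast hN
  set κ : ℝ := 8 / s ^ 2 * (L ^ N).toReal with hκ
  have hκ0 : 0 ≤ κ := by positivity
  -- So small that the quadratic term t²κ costs at most another ε/3 per unit time, after the ε/3
  -- already lost in the mean.
  obtain ⟨t, ht0, hts, htκ⟩ : ∃ t : ℝ, 0 < t ∧ t ≤ s / 2 ∧ t * κ ≤ N * (ε / 3) := by
    refine ⟨min (s / 2) (N * (ε / 3) / (κ + 1)), by positivity, min_le_left _ _, ?_⟩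
    calc _ ≤ N * (ε / 3) / (κ + 1) * (κ + 1) := by
          gcongr
          · exact min_le_right _ _
          · linarith
      _ = _ := by field_simp
  set χ : S.X → ℝ := fun y => t * φ y with hχ
  have hχm : Measurable χ := hφ.const_mul t
  have hbχ : ∀ k ω x, S.birkhoff χ k ω x = t * S.birkhoff φ k ω x := fun k ω x => by
    simp only [birkhoff, hχ, Finset.mul_sum]
  have hbψ : ∀ k ω x, |S.birkhoff φ k ω x| ≤ s⁻¹ * S.birkhoff ψ k ω x := fun k ω x => by
    simp only [birkhoff, hψ, ← Finset.mul_sum]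
    rw [inv_mul_cancel_left₀ hs.ne']
    exact Finset.abs_sum_le_sum_abs _ _
  have hLpow : ∀ k x, S.expMoment χ k x ≤ L ^ k := by
    intro k x
    refine le_trans ?_ (expMoment_le_pow hψm k x)
    refine lintegral_mono fun ω => ENNReal.ofReal_le_ofReal (Real.exp_le_exp.2 ?_)
    rw [hbχ]
    calc t * S.birkhoff φ k ω x ≤ s * |S.birkhoff φ k ω x| := by
          have h0 := abs_nonneg (S.birkhoff φ k ω x)
          have h1 := le_abs_self (S.birkhoff φ k ω x)
          calc _ ≤ t * |S.birkhoff φ k ω x| := by gcongr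
            _ ≤ _ := by gcongr; linarith
      _ ≤ s * (s⁻¹ * S.birkhoff ψ k ω x) := by gcongr; exact hbψ k ω x
      _ = _ := by field_simp
  set b : ℝ := t * N * (a + 2 * (ε / 3)) with hb
  have hblock : ∀ x ∈ Y, S.expMoment χ N x ≤ ENNReal.ofReal (Real.exp b) := by
    intro x hx
    have hfin : ∫⁻ ω, ENNReal.ofReal (Real.exp (S.birkhoff ψ N ω x)) ∂S.ℙ ≠ ∞ :=
      ne_top_of_le_ne_top (ENNReal.pow_ne_top hLtop) (expMoment_le_pow hψm N x)
    have i1 : Integrable (fun ω => Real.exp (S.birkhoff ψ N ω x)) S.ℙ := by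
      refine ⟨(measurable_birkhoff hψm N x).exp.aestronglyMeasurable, ?_⟩
      rw [hasFiniteIntegral_iff_ofReal (Eventually.of_forall fun y => (Real.exp_pos _).le)]
      exact lt_top_iff_ne_top.2 hfin
    have i3 : ∀ i, Integrable (fun ω => φ (S.iter (i + 1) ω x)) S.ℙ := fun i =>
      (integrable_map_measure hφ.aestronglyMeasurable
        (S.measurable_iter_left (i + 1) x).aemeasurable).1 (integrable_iter_succ hint i x)
    have i2 : Integrable (fun ω => S.birkhoff φ N ω x) S.ℙ :=
      integrable_finsetSum _ fun i _ => i3 i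
    have e2 : ∫ ω, S.birkhoff φ N ω x ∂S.ℙ ≤ N * (a + ε / 3) := by
      refine le_trans (le_of_eq ?_) (hmean x hx)
      exact integral_finsetSum _ fun i _ => i3 i
    have e1 : ∫ ω, Real.exp (S.birkhoff ψ N ω x) ∂S.ℙ ≤ (L ^ N).toReal := by
      rw [integral_eq_lintegral_of_nonneg_ae (Eventually.of_forall fun y => (Real.exp_pos _).le)
        i1.aestronglyMeasurable]
      exact ENNReal.toReal_mono (ENNReal.pow_ne_top hLtop) (expMoment_le_pow hψm N x)
    have hpt : ∀ ω, Real.exp (S.birkhoff χ N ω x) ≤ 1 + t * S.birkhoff φ N ω x +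
        t ^ 2 * (8 / s ^ 2 * Real.exp (S.birkhoff ψ N ω x)) := by
      intro ω
      have := Real.exp_mul_le_of_small hs ht0.le hts (hbψ N ω x)
      rw [hbχ]
      rwa [mul_inv_cancel_left₀ hs.ne'] at this
    have i4 : Integrable (fun ω => 1 + t * S.birkhoff φ N ω x) S.ℙ :=
      (integrable_const 1).add (i2.const_mul t)
    have i5 : Integrable (fun ω => t ^ 2 * (8 / s ^ 2 * Real.exp (S.birkhoff ψ N ω x))) S.ℙ :=
      (i1.const_mul _).const_mul _
    calc S.expMoment χ N x ≤ ∫⁻ ω, ENNReal.ofReal (1 + t * S.birkhoff φ N ω x +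
        t ^ 2 * (8 / s ^ 2 * Real.exp (S.birkhoff ψ N ω x))) ∂S.ℙ :=
          lintegral_mono fun ω => ENNReal.ofReal_le_ofReal (hpt ω)
      _ = ENNReal.ofReal (∫ ω, (1 + t * S.birkhoff φ N ω x +
        t ^ 2 * (8 / s ^ 2 * Real.exp (S.birkhoff ψ N ω x))) ∂S.ℙ) :=
          (ofReal_integral_eq_lintegral_ofReal (i4.add i5)
            (Eventually.of_forall fun ω => (Real.exp_pos _).le.trans (hpt ω))).symm
      _ ≤ _ := by
          refine ENNReal.ofReal_le_ofReal ?_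
          rw [integral_add i4 i5, integral_add (integrable_const 1) (i2.const_mul t),
            integral_const_mul, integral_const_mul, integral_const_mul]
          simp only [integral_const, probReal_univ, smul_eq_mul, mul_one]
          have h1 : t ^ 2 * (8 / s ^ 2 * ∫ ω, Real.exp (S.birkhoff ψ N ω x) ∂S.ℙ) ≤
              t * (N * (ε / 3)) := by
            calc _ ≤ t ^ 2 * (8 / s ^ 2 * (L ^ N).toReal) := by gcongr
              _ = t * (t * κ) := by rw [hκ]; ring
              _ ≤ _ := by gcongr
          have h2 : t * ∫ ω, S.birkhoff φ N ω x ∂S.ℙ ≤ t * (N * (a + ε / 3)) := by gcongr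
          have h3 := Real.add_one_le_exp b
          have h4 : b = t * (N * (a + ε / 3)) + t * (N * (ε / 3)) := by rw [hb]; ring
          linarith
  set M : ℝ := (max 1 L.toReal) ^ N with hM
  have hM0 : 0 < M := by positivity
  set a' : ℝ := a + 2 * (ε / 3) with ha'
  -- `k` is cut into `k / N` full blocks and a remainder shorter than `N`, bounded crudely by `M`.
  -- The factor with `|a'|` pays for replacing `N * (k / N)` by `k`, whatever the sign of `a'`.
  have hFk : ∀ x ∈ Y, ∀ k : ℕ, S.expMoment χ k x ≤
      ENNReal.ofReal (M * Real.exp (t * N * |a'|) * Real.exp (t * a' * k)) := by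
    intro x hx k
    have hk : k = k % N + k / N * N := by rw [Nat.mul_comm, Nat.mod_add_div]
    have hr : k % N < N := Nat.mod_lt k hN
    have hbound := hY.expMoment_add_le hχm (hY.expMoment_mul_le hχm hblock (k / N)) (k % N) x hx
    rw [← hk] at hbound
    refine hbound.trans ?_
    have h1 : S.expMoment χ (k % N) x ≤ ENNReal.ofReal M := by
      refine (hLpow _ x).trans ?_
      rw [← ENNReal.ofReal_toReal hLtop, ← ENNReal.ofReal_pow ENNReal.toReal_nonneg]
      refine ENNReal.ofReal_le_ofReal ?_
      calc L.toReal ^ (k % N) ≤ (max 1 L.toReal) ^ (k % N) := by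
            gcongr; exact le_max_right _ _
        _ ≤ _ := pow_le_pow_right₀ (le_max_left _ _) hr.le
    have h2 : ENNReal.ofReal (Real.exp b) ^ (k / N) ≤
        ENNReal.ofReal (Real.exp (t * N * |a'|) * Real.exp (t * a' * k)) := by
      rw [← ENNReal.ofReal_pow (Real.exp_pos _).le, ← Real.exp_nat_mul, ← Real.exp_add]
      refine ENNReal.ofReal_le_ofReal (Real.exp_le_exp.2 ?_)
      have hk' : (k : ℝ) = (k % N : ℕ) + (k / N : ℕ) * N := by exact_mod_cast hk
      have hr' : ((k % N : ℕ) : ℝ) ≤ N := by exact_mod_cast hr.le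
      have h3 : -(N * |a'|) ≤ (k % N : ℕ) * a' := by
        have h5 := neg_abs_le a'
        have h6 : (0 : ℝ) ≤ (k % N : ℕ) := Nat.cast_nonneg _
        have h7 := abs_nonneg a'
        nlinarith
      have h4 : 0 ≤ t * (N * |a'| + (k % N : ℕ) * a') := by
        refine mul_nonneg ht0.le ?_
        linarith
      rw [hk', hb]
      linarith
    rw [mul_assoc, ENNReal.ofReal_mul hM0.le]
    gcongr
  -- The rate comes from the remaining gap (a + ε) − a' = ε/3.
  refine ⟨M * Real.exp (t * N * |a'|) * Real.exp (t * K), Real.exp (-(t * (ε / 3))),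
    by positivity, by positivity, Real.exp_lt_one_iff.2 (by linarith [mul_pos ht0 hε]), ?_⟩
  intro x hx k
  set θ₀ : ℝ := k * (a + ε) - K with hθ
  have hsub : {ω | θ₀ ≤ S.birkhoff φ k ω x} ⊆ {ω | ENNReal.ofReal (Real.exp (t * θ₀)) ≤
      ENNReal.ofReal (Real.exp (S.birkhoff χ k ω x))} := by
    intro ω hω
    refine ENNReal.ofReal_le_ofReal (Real.exp_le_exp.2 ?_)
    rw [hbχ]
    exact mul_le_mul_of_nonneg_left hω ht0.le
  have hcheb := mul_meas_ge_le_lintegral (μ := S.ℙ)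
    (measurable_birkhoff hχm k x).exp.ennreal_ofReal (ENNReal.ofReal (Real.exp (t * θ₀)))
  have h1 := hcheb.trans (hFk x hx k)
  refine (measure_mono hsub).trans ?_
  have hpos : 0 < Real.exp (t * θ₀) := Real.exp_pos _
  rw [mul_comm, ← ENNReal.le_div_iff_mul_le (Or.inl (by simpa using hpos))
    (Or.inl ENNReal.ofReal_ne_top), ← ENNReal.ofReal_div_of_pos hpos] at h1
  refine h1.trans (ENNReal.ofReal_le_ofReal (le_of_eq ?_))
  have e : t * a' * k = t * K + k * -(t * (ε / 3)) + t * θ₀ := by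
    rw [hθ, ha']
    ring
  rw [div_eq_iff hpos.ne', ← Real.exp_nat_mul, e, Real.exp_add, Real.exp_add]
  ring

end NoisySystem

end

noncomputable section

/-! ### Volume of tubes around a hypersurface -/

lemma isCompact_unitCube (k : ℕ) : IsCompact (unitCube k) := by
  have : unitCube k = WithLp.toLp 2 '' (pi univ fun _ : Fin k => Icc (0 : ℝ) 1) := by
    ext t
    constructor
    · exact fun h => ⟨t.ofLp, fun j _ => h j, rfl⟩
    · rintro ⟨u, hu, rfl⟩
      exact fun j => hu j (mem_univ j)
  rw [this]
  exact (isCompact_univ_pi fun _ => isCompact_Icc).image (PiLp.continuous_toLp 2 _)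

lemma convex_unitCube (k : ℕ) : Convex ℝ (unitCube k) := by
  intro s hs t ht a b ha hb hab j
  exact (convex_Icc (0 : ℝ) 1) (hs j) (ht j) ha hb hab

lemma exists_lipschitzOnWith_unitCube {k n : ℕ} {g : Euc k → Euc n}
    (hg : ContDiffOn ℝ 1 g (unitCube k)) : ∃ L, LipschitzOnWith L g (unitCube k) :=
  LocallyLipschitzOn.exists_lipschitzOnWith_of_compact (isCompact_unitCube k) fun _ hx =>
    (hg _ hx).exists_lipschitzOnWith (convex_unitCube k)

/-- The grid point `p / N`. -/
def gridPoint {k : ℕ} (N : ℕ) (p : Fin k → Fin (N + 1)) : Euc k :=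
  WithLp.toLp 2 fun j => (p j : ℝ) / N

lemma gridPoint_mem_unitCube {k N : ℕ} (hN : 0 < N) (p : Fin k → Fin (N + 1)) :
    gridPoint N p ∈ unitCube k := by
  have hN' : (0 : ℝ) < N := by exact_mod_cast hN
  intro j
  refine ⟨div_nonneg (Nat.cast_nonneg _) hN'.le, ?_⟩
  change ((p j : ℕ) : ℝ) / N ≤ 1
  rw [div_le_one hN']
  exact_mod_cast Nat.lt_succ_iff.1 (p j).2

lemma exists_gridPoint_dist_le {k N : ℕ} (hN : 0 < N) {t : Euc k} (ht : t ∈ unitCube k) :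
    ∃ p : Fin k → Fin (N + 1), dist t (gridPoint N p) ≤ Real.sqrt k * (N : ℝ)⁻¹ := by
  have hN' : (0 : ℝ) < N := by exact_mod_cast hN
  have hfl : ∀ j, ⌊N * t j⌋₊ < N + 1 := fun j => by
    rw [Nat.lt_succ_iff]
    refine Nat.floor_le_of_le ?_
    have := (ht j).2
    nlinarith
  refine ⟨fun j => ⟨⌊N * t j⌋₊, hfl j⟩, ?_⟩
  rw [EuclideanSpace.dist_eq]
  have hb : ∀ j, dist (t j) ((gridPoint N fun j => ⟨⌊N * t j⌋₊, hfl j⟩ : Euc k) j) ≤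
      (N : ℝ)⁻¹ := by
    intro j
    change |t j - ((⌊N * t j⌋₊ : ℕ) : ℝ) / N| ≤ _
    have h0 : 0 ≤ N * t j := mul_nonneg hN'.le (ht j).1
    have h1 := Nat.floor_le h0
    have h2 := Nat.lt_floor_add_one (N * t j)
    have e : t j - ((⌊N * t j⌋₊ : ℕ) : ℝ) / N = (N * t j - (⌊N * t j⌋₊ : ℕ)) * (N : ℝ)⁻¹ := by
      field_simp
    rw [e, abs_mul, abs_of_pos (inv_pos.2 hN')]
    refine mul_le_of_le_one_left (inv_pos.2 hN').le ?_
    rw [abs_le]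
    constructor <;> linarith
  calc _ ≤ Real.sqrt (∑ _j : Fin k, (N : ℝ)⁻¹ ^ 2) := by
        refine Real.sqrt_le_sqrt (Finset.sum_le_sum fun j _ => ?_)
        exact pow_le_pow_left₀ dist_nonneg (hb j) 2
    _ = Real.sqrt (k * (N : ℝ)⁻¹ ^ 2) := by simp
    _ = _ := by rw [Real.sqrt_mul (Nat.cast_nonneg k), Real.sqrt_sq (inv_pos.2 hN').le]

/-- A grid of mesh about `r` has O(r⁻ᵏ) points, and balls of radius `R * r` around their images
cover the tube. Each has volume O(rᵏ⁺¹), leaving one power of `r`. -/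
lemma volume_tube_le {k : ℕ} {g : Euc k → Euc (k + 1)} {L : NNReal}
    (hg : LipschitzOnWith L g (unitCube k)) :
    ∃ C : ℝ, 0 ≤ C ∧ ∀ r : ℝ, 0 < r → r ≤ 1 →
      volume {y | ∃ t ∈ unitCube k, dist y (g t) ≤ r} ≤ ENNReal.ofReal (C * r) := by
  -- 1 for the distance to the hypersurface, `L * √k` for moving the parameter to a grid point.
  set R : ℝ := 1 + L * Real.sqrt k with hR
  have hR0 : 0 ≤ R := by positivity
  set V : ℝ := (volume (Metric.ball (0 : Euc (k + 1)) 1)).toReal with hV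
  have hVe : volume (Metric.ball (0 : Euc (k + 1)) 1) = ENNReal.ofReal V :=
    (ENNReal.ofReal_toReal measure_ball_lt_top.ne).symm
  refine ⟨3 ^ k * R ^ (k + 1) * V, by positivity, fun r hr hr1 => ?_⟩
  set N := ⌈r⁻¹⌉₊ with hN
  have hN0 : 0 < N := Nat.ceil_pos.2 (inv_pos.2 hr)
  have hNr : (N : ℝ)⁻¹ ≤ r := inv_le_of_inv_le₀ hr (Nat.le_ceil _)
  have hN3 : (N : ℝ) + 1 ≤ 3 / r := by
    have h1 := Nat.ceil_lt_add_one (inv_pos.2 hr).le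
    have h2 : 1 ≤ r⁻¹ := (one_le_inv₀ hr).2 hr1
    rw [div_eq_mul_inv]
    linarith
  have hcover : {y | ∃ t ∈ unitCube k, dist y (g t) ≤ r} ⊆
      ⋃ p : Fin k → Fin (N + 1), Metric.closedBall (g (gridPoint N p)) (R * r) := by
    rintro y ⟨t, ht, hy⟩
    obtain ⟨p, hp⟩ := exists_gridPoint_dist_le hN0 ht
    refine mem_iUnion.2 ⟨p, ?_⟩
    have h1 := hg.dist_le_mul t ht _ (gridPoint_mem_unitCube hN0 p)
    rw [Metric.mem_closedBall]
    calc dist y (g (gridPoint N p)) ≤ dist y (g t) + dist (g t) (g (gridPoint N p)) :=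
          dist_triangle _ _ _
      _ ≤ r + L * (Real.sqrt k * r) := by
          refine add_le_add hy (h1.trans ?_)
          gcongr
          exact hp.trans (by gcongr)
      _ = R * r := by rw [hR]; ring
  refine (measure_mono hcover).trans ((measure_iUnion_fintype_le _ _).trans ?_)
  have hball : ∀ p : Fin k → Fin (N + 1),
      volume (Metric.closedBall (g (gridPoint N p)) (R * r)) =
        ENNReal.ofReal ((R * r) ^ (k + 1) * V) := fun p => by
    rw [Measure.addHaar_closedBall _ _ (by positivity), hVe, ← ENNReal.ofReal_mul (by positivity)]
    simp
  simp only [hball, Finset.sum_const, Finset.card_univ, Fintype.card_fun, Fintype.card_fin,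
    nsmul_eq_mul]
  rw [← ENNReal.ofReal_natCast, ← ENNReal.ofReal_mul (Nat.cast_nonneg _)]
  refine ENNReal.ofReal_le_ofReal ?_
  push_cast
  calc ((N : ℝ) + 1) ^ k * ((R * r) ^ (k + 1) * V) ≤ (3 / r) ^ k * ((R * r) ^ (k + 1) * V) := by
        gcongr
    _ = _ := by
        rw [div_pow, mul_pow, pow_succ r]
        field_simp

namespace NoisySystem

open Filter Topology

variable {n : ℕ} {S : NoisySystem n}

lemma CritInHypersurface.exists_vol_le (hn : 0 < n) (hC : S.CritInHypersurface) :
    ∃ C : ℝ, 0 < C ∧ ∀ r : ℝ, 0 < r →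
      S.vol {x | Metric.infEDist (x : Euc n) S.crit ≤ ENNReal.ofReal r} ≤
        ENNReal.ofReal (C * r) := by
  obtain ⟨k, rfl⟩ : ∃ k, n = k + 1 := ⟨n - 1, by omega⟩
  obtain ⟨N, g, -, hg, -, hcrit, -⟩ := hC
  have hL := fun i => exists_lipschitzOnWith_unitCube (hg i)
  choose L hL using hL
  choose C hC0 hC using fun i => volume_tube_le (k := k) (hL i)
  set V := (S.vol univ).toReal with hV
  have hV0 : 0 ≤ V := ENNReal.toReal_nonneg
  have hsum : 0 ≤ ∑ i, C i := Finset.sum_nonneg fun i _ => hC0 i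
  -- The first 2 pays for doubling the radius, since the distance to `crit` need not be attained; `2
  -- * V` handles `r > 1/2` trivially.
  refine ⟨2 * (∑ i, C i) + 2 * V + 1, by positivity, fun r hr => ?_⟩
  rcases le_or_gt r (1 / 2) with hr2 | hr2
  · have hcover : (Subtype.val '' {x : S.X | Metric.infEDist (x : Euc (k + 1)) S.crit ≤
        ENNReal.ofReal r} : Set (Euc (k + 1))) ⊆
        ⋃ i, {y | ∃ t ∈ unitCube k, dist y (g i t) ≤ 2 * r} := by
      rintro _ ⟨x, hx, rfl⟩
      have hlt : Metric.infEDist (x : Euc (k + 1)) S.crit < ENNReal.ofReal (2 * r) :=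
        lt_of_le_of_lt hx ((ENNReal.ofReal_lt_ofReal_iff (by positivity)).2 (by linarith))
      obtain ⟨z, hz, hxz⟩ := Metric.infEDist_lt_iff.1 hlt
      obtain ⟨i, t, ht, rfl⟩ := mem_iUnion.1 (hcrit hz)
      refine mem_iUnion.2 ⟨i, t, ht, ?_⟩
      rw [edist_dist] at hxz
      exact ((ENNReal.ofReal_lt_ofReal_iff (by positivity)).1 hxz).le
    rw [vol_apply]
    refine (measure_mono hcover).trans ((measure_iUnion_fintype_le _ _).trans ?_)
    calc _ ≤ ∑ i, ENNReal.ofReal (C i * (2 * r)) :=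
          Finset.sum_le_sum fun i _ => hC i (2 * r) (by positivity) (by linarith)
      _ = ENNReal.ofReal (∑ i, C i * (2 * r)) :=
          (ENNReal.ofReal_sum_of_nonneg fun i _ => mul_nonneg (hC0 i) (by positivity)).symm
      _ ≤ _ := by
          refine ENNReal.ofReal_le_ofReal ?_
          rw [← Finset.sum_mul]
          nlinarith [mul_nonneg hV0 hr.le]
  · calc _ ≤ S.vol univ := measure_mono (subset_univ _)
      _ = ENNReal.ofReal V := (ENNReal.ofReal_toReal (measure_ne_top _ _)).symm
      _ ≤ _ := by
          refine ENNReal.ofReal_le_ofReal ?_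
          nlinarith [mul_nonneg hsum hr.le]

lemma CritInHypersurface.vol_closure_crit (hn : 0 < n) (hC : S.CritInHypersurface) :
    S.vol {x | Metric.infEDist (x : Euc n) S.crit = 0} = 0 := by
  obtain ⟨C, -, h⟩ := hC.exists_vol_le hn
  refine le_antisymm (ge_of_tendsto (x := 𝓝[>] (0 : ℝ))
    (f := fun r => ENNReal.ofReal (C * r)) ?_ ?_) zero_le
  · have : Tendsto (fun r : ℝ => ENNReal.ofReal (C * r)) (𝓝 0) (𝓝 (ENNReal.ofReal (C * 0))) :=
      (ENNReal.continuous_ofReal.comp (continuous_const.mul continuous_id)).tendsto 0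
    rw [mul_zero, ENNReal.ofReal_zero] at this
    exact this.mono_left nhdsWithin_le_nhds
  · filter_upwards [self_mem_nhdsWithin] with r hr
    refine (measure_mono fun x hx => ?_).trans (h r hr)
    exact (le_of_eq hx).trans zero_le

/-! ### The logarithmic distance to the critical set -/

/-- The positive part of `-log dist(x, 𝒞)`, set to `0` on the closure of `𝒞`. -/
def logDist (S : NoisySystem n) (x : S.X) : ℝ :=
  max 0 (-Real.log (Metric.infDist (x : Euc n) S.crit))

lemma logDist_nonneg (x : S.X) : 0 ≤ S.logDist x := le_max_left _ _

lemma measurable_logDist : Measurable S.logDist :=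
  measurable_const.max (Real.measurable_log.comp
    ((Metric.continuous_infDist_pt _).comp continuous_subtype_val).measurable).neg

lemma infEDist_le_of_le_logDist {x : S.X} {a : ℝ} (ha : 0 < a) (h : a ≤ S.logDist x) :
    Metric.infEDist (x : Euc n) S.crit ≤ ENNReal.ofReal (Real.exp (-a)) := by
  have h1 : a ≤ -Real.log (Metric.infDist (x : Euc n) S.crit) := by
    rcases le_max_iff.1 h with h | h
    · linarith
    · exact h
  -- The convention log 0 = 0 makes `logDist` vanish both on the closure of `crit` and when `crit`
  -- is empty; `0 < a` rules these out.
  have hne : Metric.infDist (x : Euc n) S.crit ≠ 0 := fun h0 => by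
    rw [h0, Real.log_zero] at h1
    linarith
  have hpos : 0 < Metric.infDist (x : Euc n) S.crit :=
    lt_of_le_of_ne Metric.infDist_nonneg hne.symm
  have htop : Metric.infEDist (x : Euc n) S.crit ≠ ∞ := fun h0 => hne (by
    rw [Metric.infDist, h0, ENNReal.toReal_top])
  rw [← ENNReal.ofReal_toReal htop]
  refine ENNReal.ofReal_le_ofReal ?_
  change Metric.infDist (x : Euc n) S.crit ≤ _
  rw [← Real.exp_log hpos]
  exact Real.exp_le_exp.2 (by linarith)

/-- Where `logDist ≥ j` the distance is at most e⁻ʲ, a set of volume O(e⁻ʲ); this beats the weight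
exp((j + 1)/2), and the sum over integer layers converges. -/
lemma CritInHypersurface.lintegral_exp_logDist (hn : 0 < n) (hC : S.CritInHypersurface) :
    ∫⁻ x, ENNReal.ofReal (Real.exp (S.logDist x / 2)) ∂S.vol ≠ ∞ := by
  obtain ⟨C, hC0, hvol⟩ := hC.exists_vol_le hn
  set V := (S.vol univ).toReal with hV
  have hV0 : 0 ≤ V := ENNReal.toReal_nonneg
  have htail : ∀ j : ℕ, S.vol {x | (j : ℝ) ≤ S.logDist x} ≤
      ENNReal.ofReal ((C + V) * Real.exp (-j)) := by
    intro j
    rcases Nat.eq_zero_or_pos j with rfl | hj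
    · calc _ ≤ S.vol univ := measure_mono (subset_univ _)
        _ = ENNReal.ofReal V := (ENNReal.ofReal_toReal (measure_ne_top _ _)).symm
        _ ≤ _ := ENNReal.ofReal_le_ofReal (by simp; linarith)
    · refine (measure_mono fun x hx => ?_).trans ((hvol _ (Real.exp_pos (-j))).trans
        (ENNReal.ofReal_le_ofReal (by gcongr; linarith)))
      exact infEDist_le_of_le_logDist (by exact_mod_cast hj) hx
  have hpt : ∀ x, ENNReal.ofReal (Real.exp (S.logDist x / 2)) ≤
      ∑' j : ℕ, {x | (j : ℝ) ≤ S.logDist x}.indicator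
        (fun _ => ENNReal.ofReal (Real.exp (((j : ℝ) + 1) / 2))) x := by
    intro x
    refine le_trans ?_ (ENNReal.le_tsum ⌊S.logDist x⌋₊)
    have hmem : x ∈ {y | (⌊S.logDist x⌋₊ : ℝ) ≤ S.logDist y} := Nat.floor_le (logDist_nonneg x)
    rw [indicator_of_mem hmem]
    refine ENNReal.ofReal_le_ofReal (Real.exp_le_exp.2 ?_)
    linarith [Nat.lt_floor_add_one (S.logDist x)]
  have hmeas : ∀ j : ℕ, MeasurableSet {x | (j : ℝ) ≤ S.logDist x} := fun j =>
    measurableSet_le measurable_const measurable_logDist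
  have hterm : ∀ j : ℕ, ENNReal.ofReal (Real.exp (((j : ℝ) + 1) / 2)) *
      S.vol {x | (j : ℝ) ≤ S.logDist x} ≤
        ENNReal.ofReal ((C + V) * Real.exp (1 / 2) * Real.exp (-(1 / 2)) ^ j) := by
    intro j
    calc _ ≤ ENNReal.ofReal (Real.exp (((j : ℝ) + 1) / 2)) *
          ENNReal.ofReal ((C + V) * Real.exp (-j)) := by gcongr; exact htail j
      _ = _ := by
        rw [← ENNReal.ofReal_mul (Real.exp_pos _).le, ← Real.exp_nat_mul]
        congr 1
        rw [mul_left_comm, ← Real.exp_add, mul_assoc, ← Real.exp_add]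
        congr 2
        ring
  have hsum : ∑' j : ℕ, ENNReal.ofReal ((C + V) * Real.exp (1 / 2) * Real.exp (-(1 / 2)) ^ j) ≠ ∞ :=
    Summable.tsum_ofReal_ne_top (Summable.mul_left _ (summable_geometric_of_lt_one
      (Real.exp_pos _).le (Real.exp_lt_one_iff.2 (by norm_num))))
  refine ne_top_of_le_ne_top hsum ((lintegral_mono hpt).trans ?_)
  rw [lintegral_tsum fun j => (measurable_const.indicator (hmeas j)).aemeasurable]
  refine ENNReal.tsum_le_tsum fun j => ?_
  rw [lintegral_indicator_const (hmeas j)]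
  exact hterm j

end NoisySystem

end

noncomputable section

namespace NoisySystem

open Filter Topology

variable {n : ℕ} {S : NoisySystem n}

/-! ### The observables -/

lemma notMem_crit_of_infEDist_ne_zero {x : Euc n} (h : Metric.infEDist x S.crit ≠ 0) :
    x ∉ S.crit := fun hx => h (Metric.infEDist_zero_of_mem hx)

lemma isInvertible_df {x : S.X} (h : Metric.infEDist (x : Euc n) S.crit ≠ 0) :
    (S.df x).IsInvertible := by
  have := notMem_crit_of_infEDist_ne_zero h
  exact (not_not.1 fun h' => this ⟨x.2, h'⟩).2.2

lemma normInv_pos (hn : 0 < n) {x : S.X} (h : Metric.infEDist (x : Euc n) S.crit ≠ 0) :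
    0 < S.normInv x := by
  obtain ⟨e, he⟩ := isInvertible_df h
  have : Nonempty (Fin n) := ⟨⟨0, hn⟩⟩
  rw [normInv, ← he, ContinuousLinearMap.inverse_equiv]
  exact e.symm.norm_pos

/-- `log ‖df(x)⁻¹‖`, set to `0` on the closure of `𝒞`. -/
def logNormInvReal (S : NoisySystem n) (x : S.X) : ℝ :=
  open Classical in
  if Metric.infEDist (x : Euc n) S.crit = 0 then 0 else Real.log (S.normInv x)

lemma continuous_infEDist_crit : Continuous fun x : S.X => Metric.infEDist (x : Euc n) S.crit :=
  Metric.continuous_infEDist.comp continuous_subtype_val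

lemma IsC1Holder.continuousOn_log_normInv (hn : 0 < n) (hf : S.IsC1Holder) :
    ContinuousOn (fun x : S.X => Real.log (S.normInv x))
      {x : S.X | Metric.infEDist (x : Euc n) S.crit ≠ 0} := by
  obtain ⟨α, hα, -, hK⟩ := hf
  intro x hx
  have hxc : (x : Euc n) ∈ S.X \ S.crit := ⟨x.2, notMem_crit_of_infEDist_ne_zero hx⟩
  obtain ⟨U, hU, K, hUK⟩ := hK x hxc
  have hdf : ContinuousWithinAt (fun y : S.X => S.df y)
      {x : S.X | Metric.infEDist (x : Euc n) S.crit ≠ 0} x := by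
    rw [ContinuousWithinAt, tendsto_iff_norm_sub_tendsto_zero]
    have hb : Tendsto (fun y : S.X => K * ‖(y : Euc n) - x‖ ^ α)
        (𝓝[{x : S.X | Metric.infEDist (x : Euc n) S.crit ≠ 0}] x) (𝓝 0) := by
      have hc : Continuous fun y : S.X => K * ‖(y : Euc n) - x‖ ^ α :=
        continuous_const.mul ((continuous_norm.comp
          (continuous_subtype_val.sub continuous_const)).rpow_const fun _ => Or.inr hα.le)
      have := hc.tendsto x
      simp only [sub_self, norm_zero, Real.zero_rpow hα.ne', mul_zero] at this
      exact this.mono_left nhdsWithin_le_nhds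
    refine squeeze_zero' (Eventually.of_forall fun _ => norm_nonneg _) ?_ hb
    have hU' : ∀ᶠ y : S.X in 𝓝[{x : S.X | Metric.infEDist (x : Euc n) S.crit ≠ 0}] x,
        (y : Euc n) ∈ U :=
      (continuous_subtype_val.tendsto x).mono_left nhdsWithin_le_nhds hU
    filter_upwards [hU', self_mem_nhdsWithin] with y hyU hy
    exact hUK y ⟨hyU, y.2, notMem_crit_of_infEDist_ne_zero hy⟩ x ⟨mem_of_mem_nhds hU, hxc⟩
  have hinv : ContinuousAt ContinuousLinearMap.inverse (S.df x) :=
    ((isInvertible_df hx).contDiffAt_map_inverse (n := 0)).continuousAt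
  have hnorm : ContinuousWithinAt (fun y : S.X => S.normInv y)
      {x : S.X | Metric.infEDist (x : Euc n) S.crit ≠ 0} x :=
    (ContinuousAt.comp_continuousWithinAt (g := ContinuousLinearMap.inverse)
      (f := fun y : S.X => S.df y) hinv hdf).norm
  exact hnorm.log (normInv_pos hn hx).ne'

/-- Cutting along the closure of `crit`, rather than `crit` itself, gives a closed set with a
continuous function on its complement. -/
lemma IsC1Holder.measurable_logNormInvReal (hn : 0 < n) (hf : S.IsC1Holder) :
    Measurable S.logNormInvReal := by
  classical
  have ho : MeasurableSet {x : S.X | Metric.infEDist (x : Euc n) S.crit = 0} :=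
    (isClosed_singleton.preimage continuous_infEDist_crit).measurableSet
  have h := ContinuousOn.measurable_piecewise
    (s := {x : S.X | Metric.infEDist (x : Euc n) S.crit = 0}) (f := fun _ => (0 : ℝ))
    (g := fun x : S.X => Real.log (S.normInv x)) continuousOn_const
    (hf.continuousOn_log_normInv hn) ho
  convert h using 1
  ext x
  by_cases hx : Metric.infEDist (x : Euc n) S.crit = 0 <;>
    simp [logNormInvReal, Set.piecewise, hx]

/-- The two-sided bounds on `df` become bounds on the norm of its inverse. If `crit` is empty they
are void, and compactness of X gives the bound instead. -/
lemma exists_abs_logNormInvReal_le (hn : 0 < n) (hf : S.IsC1Holder) (hB : S.CritNondegenerate) :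
    ∃ K β : ℝ, 0 ≤ K ∧ 0 < β ∧ ∀ x, |S.logNormInvReal x| ≤ K + β * S.logDist x := by
  obtain ⟨B, β, hB1, hβ, hbound, -⟩ := hB
  rcases S.crit.eq_empty_or_nonempty with hempty | hne
  · have huniv : {x : S.X | Metric.infEDist (x : Euc n) S.crit ≠ 0} = univ := by
      ext x
      simp [hempty]
    have hcont := hf.continuousOn_log_normInv hn
    rw [huniv] at hcont
    obtain ⟨K, hK⟩ := isCompact_univ.exists_bound_of_continuousOn hcont
    refine ⟨max K 0, β, le_max_right _ _, hβ, fun x => ?_⟩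
    have h1 : S.logNormInvReal x = Real.log (S.normInv x) := by
      simp [logNormInvReal, hempty]
    rw [h1]
    have h2 := mul_nonneg hβ.le (logDist_nonneg x)
    have h3 := hK x (mem_univ x)
    rw [Real.norm_eq_abs] at h3
    linarith [le_max_left K 0]
  · have hlogB : 0 ≤ Real.log B := Real.log_nonneg hB1.le
    refine ⟨Real.log B, β, hlogB, hβ, fun x => ?_⟩
    have hl := mul_nonneg hβ.le (logDist_nonneg x)
    by_cases hx : Metric.infEDist (x : Euc n) S.crit = 0
    · simp only [logNormInvReal, hx, if_true, abs_zero]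
      linarith
    have hφ : S.logNormInvReal x = Real.log (S.normInv x) := by simp [logNormInvReal, hx]
    set d := Metric.infDist (x : Euc n) S.crit with hd
    have hd0 : 0 < d := ENNReal.toReal_pos hx (Metric.infEDist_ne_top hne)
    have hld : -Real.log d ≤ S.logDist x := le_max_right _ _
    have hB0 : 0 < B := by linarith
    have hpow : 0 < d ^ β := Real.rpow_pos_of_pos hd0 β
    have hbx := hbound x ⟨x.2, notMem_crit_of_infEDist_ne_zero hx⟩
    have hpos := normInv_pos hn hx
    obtain ⟨e, he⟩ := isInvertible_df hx
    have hni : S.normInv x = ‖(e.symm : Euc n →L[ℝ] Euc n)‖ := by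
      rw [normInv, ← he, ContinuousLinearMap.inverse_equiv]
    have hupper : S.normInv x ≤ B / d ^ β := by
      rw [hni]
      refine ContinuousLinearMap.opNorm_le_bound _ (by positivity) fun v => ?_
      have := (hbx (e.symm v)).1
      rw [← he] at this
      simp only [ContinuousLinearEquiv.coe_coe, ContinuousLinearEquiv.apply_symm_apply] at this ⊢
      rw [div_mul_eq_mul_div, le_div_iff₀ hpow]
      linarith
    have hlower : d ^ β / B ≤ S.normInv x := by
      have : Nonempty (Fin n) := ⟨⟨0, hn⟩⟩
      obtain ⟨v, hv⟩ := exists_ne (0 : Euc n)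
      have hv0 : 0 < ‖v‖ := norm_pos_iff.2 hv
      have h1 := (hbx v).2
      rw [← he] at h1
      have h2 := (e.symm : Euc n →L[ℝ] Euc n).le_opNorm (e v)
      simp only [ContinuousLinearEquiv.coe_coe, ContinuousLinearEquiv.symm_apply_apply] at h1 h2
      rw [← hni] at h2
      rw [div_le_iff₀ hB0]
      have h3 : d ^ β * ‖v‖ ≤ S.normInv x * B * ‖v‖ := by
        calc d ^ β * ‖v‖ ≤ d ^ β * (S.normInv x * ‖e v‖) := by gcongr
          _ = S.normInv x * (d ^ β * ‖e v‖) := by ring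
          _ ≤ S.normInv x * (B * ‖v‖) := by gcongr
          _ = _ := by ring
      exact le_of_mul_le_mul_right h3 hv0
    rw [hφ, abs_le]
    constructor
    · have := Real.log_le_log (by positivity) hlower
      rw [Real.log_div hpow.ne' hB0.ne', Real.log_rpow hd0] at this
      nlinarith
    · have := Real.log_le_log hpos hupper
      rw [Real.log_div hB0.ne' hpow.ne', Real.log_rpow hd0] at this
      nlinarith

lemma logNormInv_eq {x : S.X} (h : Metric.infEDist (x : Euc n) S.crit ≠ 0) :
    S.logNormInv x = (S.logNormInvReal x : EReal) := by
  simp [logNormInv, logNormInvReal, h, notMem_crit_of_infEDist_ne_zero h]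

/-- `-log dist_δ(x, 𝒞)`, set to `0` on the closure of `𝒞`. -/
def truncLogDist (S : NoisySystem n) (δ : ℝ) (x : S.X) : ℝ :=
  if Metric.infEDist (x : Euc n) S.crit ≤ ENNReal.ofReal δ then S.logDist x else 0

lemma truncLogDist_nonneg (δ : ℝ) (x : S.X) : 0 ≤ S.truncLogDist δ x := by
  unfold truncLogDist
  split_ifs
  exacts [logDist_nonneg x, le_rfl]

lemma truncLogDist_le (δ : ℝ) (x : S.X) : S.truncLogDist δ x ≤ S.logDist x := by
  unfold truncLogDist
  split_ifs
  exacts [le_rfl, logDist_nonneg x]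

lemma measurable_truncLogDist (δ : ℝ) : Measurable (S.truncLogDist δ) :=
  Measurable.ite (isClosed_Iic.preimage continuous_infEDist_crit).measurableSet
    measurable_logDist measurable_const

/-- For δ < 1 the truncation only keeps distances below 1, so the positive part in `logDist` changes
nothing. -/
lemma neg_log_distTrunc_eq {δ : ℝ} (hδ : δ < 1) {x : S.X}
    (h : Metric.infEDist (x : Euc n) S.crit ≠ 0) :
    -ENNReal.log (S.distTrunc δ x) = (S.truncLogDist δ x : EReal) := by
  unfold distTrunc truncLogDist
  by_cases hx : Metric.infEDist (x : Euc n) S.crit ≤ ENNReal.ofReal δ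
  · rw [if_neg (not_lt.2 hx), if_pos hx]
    have htop : Metric.infEDist (x : Euc n) S.crit ≠ ∞ :=
      ne_top_of_le_ne_top ENNReal.ofReal_ne_top hx
    have hpos : 0 < Metric.infDist (x : Euc n) S.crit := ENNReal.toReal_pos h htop
    have he : Metric.infEDist (x : Euc n) S.crit =
        ENNReal.ofReal (Metric.infDist (x : Euc n) S.crit) := (ENNReal.ofReal_toReal htop).symm
    have hle : Metric.infDist (x : Euc n) S.crit ≤ 1 := by
      rw [he] at hx
      rcases le_or_gt 0 δ with h0 | h0
      · exact ((ENNReal.ofReal_le_ofReal_iff h0).1 hx).trans hδ.le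
      · rw [ENNReal.ofReal_of_nonpos h0.le] at hx
        exact absurd hx (not_le.2 (ENNReal.ofReal_pos.2 hpos))
    rw [he, ENNReal.log_ofReal_of_pos hpos, logDist, max_eq_right, EReal.coe_neg]
    exact neg_nonneg.2 (Real.log_nonpos hpos.le hle)
  · rw [if_pos (not_le.1 hx), if_neg hx]
    simp

lemma tendsto_truncLogDist (x : S.X) :
    Tendsto (fun k : ℕ => S.truncLogDist (1 / ((k : ℝ) + 1)) x) atTop (𝓝 0) := by
  by_cases h : Metric.infEDist (x : Euc n) S.crit = 0
  · have h0 : S.logDist x = 0 := by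
      simp [logDist, Metric.infDist, h]
    refine tendsto_const_nhds.congr fun k => ?_
    unfold truncLogDist
    split_ifs
    exacts [h0.symm, rfl]
  · have ht : Tendsto (fun k : ℕ => ENNReal.ofReal (1 / ((k : ℝ) + 1))) atTop (𝓝 0) := by
      rw [← ENNReal.ofReal_zero]
      exact (ENNReal.continuous_ofReal.tendsto 0).comp tendsto_one_div_add_atTop_nhds_zero_nat
    refine tendsto_const_nhds.congr' ?_
    filter_upwards [ht.eventually_lt_const (pos_iff_ne_zero.2 h)] with k hk
    rw [truncLogDist, if_neg (not_le.2 hk)]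

lemma truncLogDist_mono {δ δ' : ℝ} (h : δ ≤ δ') (x : S.X) :
    S.truncLogDist δ x ≤ S.truncLogDist δ' x := by
  by_cases hx : Metric.infEDist (x : Euc n) S.crit ≤ ENNReal.ofReal δ
  · rw [truncLogDist, truncLogDist, if_pos hx, if_pos (hx.trans (ENNReal.ofReal_le_ofReal h))]
  · rw [truncLogDist, if_neg hx]
    exact truncLogDist_nonneg _ x

lemma CritInHypersurface.integrable_logDist (hn : 0 < n) (hC : S.CritInHypersurface) :
    Integrable S.logDist S.vol := by
  have h1 : Integrable (fun x => Real.exp (S.logDist x / 2)) S.vol := by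
    refine ⟨(measurable_logDist.div_const 2).exp.aestronglyMeasurable, ?_⟩
    rw [hasFiniteIntegral_iff_ofReal (Eventually.of_forall fun y => (Real.exp_pos _).le)]
    exact lt_top_iff_ne_top.2 (hC.lintegral_exp_logDist hn)
  refine (h1.const_mul 2).mono' measurable_logDist.aestronglyMeasurable
    (Eventually.of_forall fun x => ?_)
  rw [Real.norm_of_nonneg (logDist_nonneg x)]
  linarith [Real.add_one_le_exp (S.logDist x / 2)]

/-- The mean of the truncated logarithmic distance is small for small truncation parameters. -/
lemma CritInHypersurface.exists_integral_truncLogDist_le (hn : 0 < n) (hC : S.CritInHypersurface)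
    {m : Measure S.X} [IsProbabilityMeasure m] (hm : S.IsStationary m) {ε : ℝ} (hε : 0 < ε) :
    ∃ δ₀ : ℝ, 0 < δ₀ ∧ δ₀ ≤ 1 ∧ ∀ δ, δ < δ₀ → ∫ x, S.truncLogDist δ x ∂m ≤ ε := by
  have hint : Integrable S.logDist m :=
    ((hC.integrable_logDist hn).smul_measure S.densBound_ne_top).mono_measure hm.le_vol
  have hbd : ∀ δ x, ‖S.truncLogDist δ x‖ ≤ S.logDist x := fun δ x => by
    rw [Real.norm_of_nonneg (truncLogDist_nonneg δ x)]
    exact truncLogDist_le δ x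
  have hi : ∀ δ, Integrable (S.truncLogDist δ) m := fun δ =>
    hint.mono' (measurable_truncLogDist δ).aestronglyMeasurable (Eventually.of_forall (hbd δ))
  have h := tendsto_integral_of_dominated_convergence (μ := m)
    (F := fun (k : ℕ) x => S.truncLogDist (1 / ((k : ℝ) + 1)) x) (f := fun _ => (0 : ℝ)) S.logDist
    (fun k => (measurable_truncLogDist _).aestronglyMeasurable) hint
    (fun k => Eventually.of_forall (hbd _)) (Eventually.of_forall tendsto_truncLogDist)
  rw [integral_zero] at h
  obtain ⟨k, hk⟩ := (h.eventually_lt_const hε).exists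
  refine ⟨1 / ((k : ℝ) + 1), by positivity, ?_, fun δ hδ => ?_⟩
  · rw [div_le_one (by positivity)]
    linarith [Nat.cast_nonneg (α := ℝ) k]
  · exact (integral_mono (hi _) (hi _) fun x => truncLogDist_mono hδ.le x).trans hk.le

end NoisySystem

end

noncomputable section

namespace NoisySystem

open Filter Topology

variable {n : ℕ} {S : NoisySystem n}

/-! ### Large deviations of observables with logarithmic poles on the critical set -/

lemma IsErgodicComponent.large_deviation_of_le_logDist {Y : Set S.X} {μ : Measure S.X}
    (hn : 0 < n) (hC : S.CritInHypersurface) (hY : S.IsErgodicComponent Y μ) {φ : S.X → ℝ}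
    (hφ : Measurable φ) {K β : ℝ} (hβ : 0 < β) (hbd : ∀ x, |φ x| ≤ K + β * S.logDist x)
    {ε : ℝ} (hε : 0 < ε) :
    ∃ C γ : ℝ, 0 < C ∧ 0 < γ ∧ γ < 1 ∧ ∀ x ∈ Y, ∀ k : ℕ, β * S.logDist x ≤ k * (ε / 2) →
      S.ℙ {ω | k * (∫ y, φ y ∂μ + ε) < ∑ i ∈ Finset.range (k + 1), φ (S.iter i ω x)} ≤
        ENNReal.ofReal (C * γ ^ k) := by
  have hexp : ∫⁻ y, ENNReal.ofReal (Real.exp (1 / (2 * β) * |φ y|)) ∂S.vol ≠ ∞ := by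
    have hle : ∀ y, ENNReal.ofReal (Real.exp (1 / (2 * β) * |φ y|)) ≤
        ENNReal.ofReal (Real.exp (K / (2 * β))) *
          ENNReal.ofReal (Real.exp (S.logDist y / 2)) := by
      intro y
      rw [← ENNReal.ofReal_mul (Real.exp_pos _).le, ← Real.exp_add]
      refine ENNReal.ofReal_le_ofReal (Real.exp_le_exp.2 ?_)
      calc 1 / (2 * β) * |φ y| ≤ 1 / (2 * β) * (K + β * S.logDist y) := by
            gcongr; exact hbd y
        _ = _ := by field_simp
    refine ne_top_of_le_ne_top ?_ (lintegral_mono hle)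
    rw [lintegral_const_mul _ (measurable_logDist.div_const 2).exp.ennreal_ofReal]
    exact ENNReal.mul_ne_top ENNReal.ofReal_ne_top (hC.lintegral_exp_logDist hn)
  -- The time-0 term is at most K + β · `logDist x` ≤ K + k · ε/2: the slack `K` and half of `ε` are
  -- reserved for it.
  obtain ⟨C, γ, hC0, hγ0, hγ1, h⟩ := hY.large_deviation hφ (s := 1 / (2 * β)) (by positivity) hexp
    (ε := ε / 2) (by positivity) K
  refine ⟨C, γ, hC0, hγ0, hγ1, fun x hx k hk => (measure_mono fun ω hω => ?_).trans (h x hx k)⟩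
  simp only [mem_ofPred_eq] at hω ⊢
  rw [Finset.sum_range_succ'] at hω
  have h1 : φ (S.iter 0 ω x) ≤ K + β * S.logDist x := (le_abs_self _).trans (hbd x)
  change _ < S.birkhoff φ k ω x + _ at hω
  linarith

/-- The closure of `crit` is Lebesgue null and laws at times ≥ 1 are absolutely continuous; thus
infinite values almost surely never occur. -/
lemma CritInHypersurface.ae_infEDist_iter_ne_zero (hn : 0 < n) (hC : S.CritInHypersurface)
    {x : S.X} (hx : Metric.infEDist (x : Euc n) S.crit ≠ 0) :
    ∀ᵐ ω ∂S.ℙ, ∀ i, Metric.infEDist (S.iter i ω x : Euc n) S.crit ≠ 0 := by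
  rw [ae_all_iff]
  intro i
  cases i with
  | zero => exact Eventually.of_forall fun _ => hx
  | succ i =>
    have h0 : ∀ᵐ y : S.X ∂S.vol, Metric.infEDist (y : Euc n) S.crit ≠ 0 := by
      rw [ae_iff]
      simpa using hC.vol_closure_crit hn
    have h1 : ∀ᵐ y : S.X ∂(S.densBound • S.vol), Metric.infEDist (y : Euc n) S.crit ≠ 0 :=
      (Measure.smul_absolutelyContinuous (c := S.densBound)).ae_le h0
    exact ae_of_ae_map (S.measurable_iter_left _ x).aemeasurable
      (ae_mono (S.map_iter_succ_le i x) h1)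

lemma CritInHypersurface.measure_lt_ereal_average_le (hn : 0 < n) (hC : S.CritInHypersurface)
    {g : S.X → EReal} {φ : S.X → ℝ}
    (hg : ∀ x : S.X, Metric.infEDist (x : Euc n) S.crit ≠ 0 → g x = (φ x : EReal))
    {x : S.X} (hx : Metric.infEDist (x : Euc n) S.crit ≠ 0) {k : ℕ} (hk : 0 < k) (c : ℝ) :
    S.ℙ {ω | (c : EReal) < (∑ i ∈ Finset.range (k + 1), g (S.iter i ω x)) / (k : EReal)} ≤
      S.ℙ {ω | k * c < ∑ i ∈ Finset.range (k + 1), φ (S.iter i ω x)} := by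
  have hk0 : (0 : ℝ) < k := by exact_mod_cast hk
  refine measure_mono_ae ?_
  filter_upwards [hC.ae_infEDist_iter_ne_zero hn hx] with ω hω h
  have e : (∑ i ∈ Finset.range (k + 1), g (S.iter i ω x)) / (k : EReal) =
      (((∑ i ∈ Finset.range (k + 1), φ (S.iter i ω x)) / k : ℝ) : EReal) := by
    rw [Finset.sum_congr rfl fun i _ => hg _ (hω i), EReal.coe_div]
    congr 1
    exact (map_sum (⟨⟨fun a : ℝ => (a : EReal), EReal.coe_zero⟩, EReal.coe_add⟩ : ℝ →+ EReal)
      _ _).symm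
  change (c : EReal) < _ at h
  rw [e, EReal.coe_lt_coe_iff, lt_div_iff₀ hk0] at h
  change (k : ℝ) * c < _
  linarith

lemma IsErgodicComponent.lam_eq {Y : Set S.X} {μ : Measure S.X} (hn : 0 < n)
    (hC : S.CritInHypersurface) (hY : S.IsErgodicComponent Y μ) :
    S.lam Y μ = ∫ x, S.logNormInvReal x ∂μ := by
  obtain ⟨-, -, ⟨hp, hs, -⟩, hYc, -⟩ := hY
  have hae : ∀ᵐ x ∂μ, x ∈ Y := by
    rw [ae_iff]
    exact hYc
  have h0 : ∀ᵐ y : S.X ∂μ, Metric.infEDist (y : Euc n) S.crit ≠ 0 := by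
    refine ae_mono hs.le_vol ((Measure.smul_absolutelyContinuous (c := S.densBound)).ae_le ?_)
    change ∀ᵐ y : S.X ∂S.vol, Metric.infEDist (y : Euc n) S.crit ≠ 0
    rw [ae_iff]
    simpa using hC.vol_closure_crit hn
  rw [lam, Measure.restrict_eq_self_of_ae_mem hae]
  refine integral_congr_ae ?_
  filter_upwards [h0] with x hx
  rw [logNormInv_eq hx, EReal.toReal_coe]

end NoisySystem

end

/-! ### The two deviation estimates combined. -/

theorem proposition3p1 (n : ℕ) (hn : 0 < n) (S : NoisySystem n)
    (hf : S.IsC1Holder) (hC : S.CritInHypersurface) (hB : S.CritNondegenerate)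
    (Y : Set S.X) (μ : Measure S.X)
    (hY : S.IsErgodicComponent Y μ) (hlam : S.lam Y μ < 0) :
    ∃ ε₀ : ℝ, 0 < ε₀ ∧ ∀ ε : ℝ, 0 < ε → ε < ε₀ →
      ∃ δ₀ : ℝ, 0 < δ₀ ∧ ∀ δ : ℝ, 0 < δ → δ < δ₀ →
        ∃ (C γ : ℝ) (A : ℕ → Set S.X), 1 < C ∧ 0 < γ ∧ γ < 1 ∧
          ∀ k : ℕ, MeasurableSet (A k) ∧
            volume (Subtype.val '' A k : Set (Euc n)) ≤ ENNReal.ofReal (C * γ ^ k) ∧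
            ∀ x ∈ Y, x ∉ A k →
              S.ℙ {ω | ((S.lam Y μ + ε : ℝ) : EReal) < S.Sav k ω x ∨
                  (ε : EReal) < S.Zav δ k ω x} < ENNReal.ofReal (C * γ ^ k) := by
  -- The argument works for every ε > 0, so the threshold 1 is arbitrary.
  refine ⟨1, one_pos, fun ε hε _ => ?_⟩
  have hμp : IsProbabilityMeasure μ := hY.2.2.1.1
  -- The mean of the truncated term takes half of ε; the other half is left for its deviation.
  obtain ⟨δ₀, hδ₀, hδ₀1, hδint⟩ :=
    hC.exists_integral_truncLogDist_le hn hY.2.2.1.2.1 (half_pos hε)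
  refine ⟨δ₀, hδ₀, fun δ _ hδ => ?_⟩
  obtain ⟨K, β, hK, hβ, hbd⟩ := NoisySystem.exists_abs_logNormInvReal_le hn hf hB
  obtain ⟨C₁, γ₁, hC₁, hγ₁, hγ₁1, hS⟩ := hY.large_deviation_of_le_logDist hn hC
    (hf.measurable_logNormInvReal hn) hβ hbd hε
  have hbdZ : ∀ x, |S.truncLogDist δ x| ≤ 0 + 1 * S.logDist x := fun x => by
    rw [abs_of_nonneg (NoisySystem.truncLogDist_nonneg δ x), zero_add, one_mul]
    exact NoisySystem.truncLogDist_le δ x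
  obtain ⟨C₂, γ₂, hC₂, hγ₂, hγ₂1, hZ⟩ := hY.large_deviation_of_le_logDist hn hC
    (NoisySystem.measurable_truncLogDist δ) one_pos hbdZ (half_pos hε)
  obtain ⟨C₃, hC₃, hvol⟩ := hC.exists_vol_le hn
  -- Off A_k one has `logDist x ≤ c * k`; this `c` gives both β c ≤ ε/2, for S_k, and c ≤ ε/4, for
  -- Z_k at deviation ε/2.
  set c : ℝ := ε / (4 * (β + 1)) with hc
  have hc0 : 0 < c := by positivity
  have hc1 : c * (4 * (β + 1)) = ε := by rw [hc]; field_simp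
  set γ₃ : ℝ := Real.exp (-c) with hγ₃
  have hγ₃1 : γ₃ < 1 := Real.exp_lt_one_iff.2 (by linarith)
  have hγ₃k : ∀ k : ℕ, Real.exp (-(c * k)) = γ₃ ^ k := fun k => by
    rw [hγ₃, ← Real.exp_nat_mul]
    congr 1
    ring
  set γ : ℝ := max γ₁ (max γ₂ γ₃) with hγ
  have hγ0 : 0 < γ := lt_max_of_lt_left hγ₁
  refine ⟨C₁ + C₂ + C₃ + 2, γ, fun k => {x | Metric.infEDist (x : Euc n) S.crit ≤
    ENNReal.ofReal (Real.exp (-(c * k)))}, by linarith, hγ0,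
    max_lt hγ₁1 (max_lt hγ₂1 hγ₃1), fun k => ⟨?_, ?_, fun x hxY hxA => ?_⟩⟩
  · exact (isClosed_Iic.preimage NoisySystem.continuous_infEDist_crit).measurableSet
  · rw [← S.vol_apply]
    refine (hvol _ (Real.exp_pos _)).trans (ENNReal.ofReal_le_ofReal ?_)
    rw [hγ₃k]
    have : γ₃ ^ k ≤ γ ^ k :=
      pow_le_pow_left₀ (Real.exp_pos _).le ((le_max_right _ _).trans (le_max_right _ _)) k
    gcongr
    linarith
  have hγk : 0 < γ ^ k := pow_pos hγ0 k
  -- At k = 0 the bound exceeds 1, so no property of the averages is needed.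
  rcases Nat.eq_zero_or_pos k with rfl | hk
  · refine lt_of_le_of_lt prob_le_one ?_
    rw [← ENNReal.ofReal_one, ENNReal.ofReal_lt_ofReal_iff (by positivity)]
    simp only [pow_zero, mul_one]
    linarith
  have hk0 : (0 : ℝ) < k := by exact_mod_cast hk
  have hxA' : ENNReal.ofReal (Real.exp (-(c * k))) < Metric.infEDist (x : Euc n) S.crit :=
    not_le.1 hxA
  have hx0 : Metric.infEDist (x : Euc n) S.crit ≠ 0 := (zero_le.trans_lt hxA').ne'
  have hlog : S.logDist x ≤ c * k := by
    by_contra hcon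
    rw [not_le] at hcon
    have hpos : 0 < c * k := by positivity
    exact absurd (NoisySystem.infEDist_le_of_le_logDist hpos hcon.le) (not_le.2 hxA')
  have hlog0 := S.logDist_nonneg x
  have hPS : S.ℙ {ω | ((S.lam Y μ + ε : ℝ) : EReal) < S.Sav k ω x} ≤
      ENNReal.ofReal (C₁ * γ₁ ^ k) := by
    refine (hC.measure_lt_ereal_average_le hn (g := fun y => S.logNormInv y)
      (fun y hy => NoisySystem.logNormInv_eq hy) hx0 hk _).trans ?_
    rw [hY.lam_eq hn hC]
    refine hS x hxY k ?_
    have : β * S.logDist x ≤ β * (c * k) := by gcongr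
    nlinarith [mul_pos hc0 hk0]
  have hPZ : S.ℙ {ω | (ε : EReal) < S.Zav δ k ω x} ≤ ENNReal.ofReal (C₂ * γ₂ ^ k) := by
    refine (hC.measure_lt_ereal_average_le hn
      (g := fun y => -ENNReal.log (S.distTrunc δ y))
      (fun y hy => NoisySystem.neg_log_distTrunc_eq (hδ.trans_le hδ₀1) hy) hx0 hk _).trans ?_
    refine (measure_mono fun ω hω => ?_).trans (hZ x hxY k ?_)
    · simp only [mem_ofPred_eq] at hω ⊢
      refine lt_of_le_of_lt ?_ hω
      have := hδint δ hδ
      gcongr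
      linarith
    · nlinarith [mul_pos (mul_pos hc0 hk0) hβ]
  have h₁ : γ₁ ^ k ≤ γ ^ k := pow_le_pow_left₀ hγ₁.le (le_max_left _ _) k
  have h₂ : γ₂ ^ k ≤ γ ^ k :=
    pow_le_pow_left₀ hγ₂.le ((le_max_left _ _).trans (le_max_right _ _)) k
  calc _ ≤ S.ℙ {ω | ((S.lam Y μ + ε : ℝ) : EReal) < S.Sav k ω x} +
        S.ℙ {ω | (ε : EReal) < S.Zav δ k ω x} := measure_union_le _ _
    _ ≤ ENNReal.ofReal (C₁ * γ₁ ^ k) + ENNReal.ofReal (C₂ * γ₂ ^ k) := add_le_add hPS hPZ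
    _ = ENNReal.ofReal (C₁ * γ₁ ^ k + C₂ * γ₂ ^ k) :=
        (ENNReal.ofReal_add (by positivity) (by positivity)).symm
    _ < _ := by
        rw [ENNReal.ofReal_lt_ofReal_iff (by positivity)]
        nlinarith [mul_le_mul_of_nonneg_left h₁ hC₁.le, mul_le_mul_of_nonneg_left h₂ hC₂.le,
          mul_pos hC₃ hγk]
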